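/- Let $0<\alpha<2$, $1\le p<\infty$ and $p>\alpha$. Let $E\subset\mathbb R^m$ be a Borel set with $0<|E|<\infty$, and let $T\subset\mathbb R^d$ be a (Lebesgue) measurable set with $|T|>0$, where $|\cdot|$ is Lebesgue measure. On a probability space let $\Gamma_1<\Gamma_2<\dots$ be the arrival times of a Poisson process of rate $1$, that is, $\Gamma_k=\tau_1+\dots+\tau_k$ with i.i.d. standard exponential $\tau_j$, and let $(V_k,\rho_k)_{k\ge1}$ be an i.i.d. sequence, independent of $(\Gamma_k)_{k\ge1}$, where $V_k$ is uniformly distributed on $E$ and $\rho_k$ is $\{-1,1\}$-valued with $P(\rho_k=1\mid V_k)=P(\rho_k=-1\mid V_k)=\tfrac12$. Put $$C_\alpha=\Big(\int_0^\infty x^{-\alpha}\sin x\,dx\Big)^{-1},$$ where the integral is the improper integral $\lim_{R\to\infty}\int_0^R$. Let $f:T\times E\to\mathbb C$ be Borel measurable with $\int_T\int_E|f(x,x')|^p\,dx'\,dx<\infty$. Then almost surely $f(\cdot,V_k)\in L^p(T)$ for all $k$, and the series $$U(x)=(C_\alpha|E|)^{1/\alpha}\sum_{k=1}^\infty\rho_k\,\Gamma_k^{-1/\alpha}f(x,V_k)$$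 converges almost surely in (complex-valued) $L^p(T)$. Its sum $U$ (on a suitable event of probability one, and defined for instance as $0$ elsewhere) is an $L^p(T)$-valued random variable, and the law of $U$ on $L^p(T)$ is symmetric $\alpha$-stable, that is: * (stable of index $\alpha$) if $U_1,U_2$ are independent copies of $U$, then for all $a,b>0$ there is $v\in L^p(T)$ such that $aU_1+bU_2$ has the same distribution as $cU+v$, where $c=(a^\alpha+b^\alpha)^{1/\alpha}$; * (symmetric) for every continuous real-linear form $\lambda:L^p(T)\to\mathbb R$ there is $\sigma_\lambda\ge0$ such that $\mathbb E\big[e^{it\lambda(U)}\big]=e^{-\sigma_\lambda^\alpha|t|^\alpha}$ for all $t\in\mathbb R$. -/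

import Mathlib

open MeasureTheory ProbabilityTheory Filter Topology
open scoped ENNReal

/-- Lebesgue measure on a subset `S` of `ℝⁿ`, as a measure on the subtype `S`. -/
noncomputable abbrev lebesgueOn {n : ℕ} (S : Set (EuclideanSpace ℝ (Fin n))) : Measure S :=
  Measure.comap Subtype.val volume

/-- The space `L^p` carries its Borel `σ`-algebra. -/
noncomputable instance Lp.instMeasurableSpaceBorel {X F : Type*} [MeasurableSpace X] [NormedAddCommGroup F]
    (p : ℝ≥0∞) [Fact (1 ≤ p)] (μ : Measure X) : MeasurableSpace (Lp F p μ) :=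
  borel _

instance Lp.instBorelSpace {X F : Type*} [MeasurableSpace X] [NormedAddCommGroup F]
    (p : ℝ≥0∞) [Fact (1 ≤ p)] (μ : Measure X) : BorelSpace (Lp F p μ) :=
  ⟨rfl⟩

/-- `C_α = (∫_0^∞ x^{-α} sin x dx)⁻¹`. The integral is an improper one (it converges only
conditionally for `α ≤ 1`), so it is the limit of the integrals over `[0, R]` as `R → ∞`. -/
noncomputable def stableConst (α : ℝ) : ℝ :=
  (limUnder atTop fun R : ℝ => ∫ x in (0 : ℝ)..R, x ^ (-α) * Real.sin x)⁻¹

/-- `Γ 0, Γ 1, …` are the successive arrival times of a Poisson process of rate `1`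
(`Γ k` is the `(k+1)`-st arrival): partial sums of i.i.d. standard exponential waiting times. -/
def IsPoissonArrivalTimes {Ω : Type*} [MeasurableSpace Ω] (P : Measure Ω)
    (Γ : ℕ → Ω → ℝ) : Prop :=
  ∃ τ : ℕ → Ω → ℝ,
    (∀ j, Measurable (τ j)) ∧ (∀ j, P.map (τ j) = expMeasure 1) ∧ iIndepFun τ P ∧
      ∀ k ω, Γ k ω = ∑ j ∈ Finset.range (k + 1), τ j ω

/-- The random input of the LePage series: Poisson arrival times `Γ`, and, independent of them,
an i.i.d. sequence of pairs `(V k, ρ k)` where `V k` is uniform on `E` and `ρ k` is a random sign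
which is fair conditionally on `V k`. (All pairs have the same law because the law of `V k` and
the conditional law of `ρ k` given `V k` are prescribed.) -/
structure IsLePageInput {Ω : Type*} [MeasurableSpace Ω] (P : Measure Ω) {m : ℕ}
    (E : Set (EuclideanSpace ℝ (Fin m)))
    (Γ : ℕ → Ω → ℝ) (V : ℕ → Ω → E) (ρ : ℕ → Ω → ℝ) : Prop where
  arrivals : IsPoissonArrivalTimes P Γ
  measurable_V : ∀ k, Measurable (V k)
  measurable_ρ : ∀ k, Measurable (ρ k)
  uniform : ∀ k, pdf.IsUniform (fun ω => (V k ω : EuclideanSpace ℝ (Fin m))) E P volume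
  sign : ∀ k ω, ρ k ω = 1 ∨ ρ k ω = -1
  fair : ∀ k,
    P⟦ρ k ⁻¹' {1} | MeasurableSpace.comap (V k) inferInstance⟧ =ᵐ[P] fun _ => (1 / 2 : ℝ)
  iIndep_pairs : iIndepFun (fun k ω => (V k ω, ρ k ω)) P
  indep_arrivals : IndepFun (fun ω k => Γ k ω) (fun ω k => (V k ω, ρ k ω)) P

/-- The `N`-th partial sum
`(C_α |E|)^{1/α} ∑_{k < N} ρ_k Γ_k^{-1/α} f(x, V_k)` of the LePage series, as a function of `x`. -/
noncomputable def lePageSum {Ω : Type*} {d m : ℕ} (α : ℝ)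
    {T : Set (EuclideanSpace ℝ (Fin d))} {E : Set (EuclideanSpace ℝ (Fin m))} (f : T × E → ℂ)
    (Γ : ℕ → Ω → ℝ) (V : ℕ → Ω → E) (ρ : ℕ → Ω → ℝ) (N : ℕ) (ω : Ω) (x : T) : ℂ :=
  (((stableConst α * (volume E).toReal) ^ (1 / α) : ℝ) : ℂ) *
    ∑ k ∈ Finset.range N, ((ρ k ω * (Γ k ω) ^ (-(1 / α)) : ℝ) : ℂ) * f (x, V k ω)

/-- A law `ν` on a normed space is `α`-stable: for all `a, b > 0` there is a vector `v` such that,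
if `U, U₁, U₂` are independent with law `ν`, then `a U₁ + b U₂` and `c U + v` have the same law,
where `c > 0` is given by `c ^ α = a ^ α + b ^ α`. -/
def IsAlphaStable {F : Type*} [NormedAddCommGroup F] [NormedSpace ℝ F] [MeasurableSpace F]
    (α : ℝ) (ν : Measure F) : Prop :=
  ∀ a b : ℝ, 0 < a → 0 < b → ∃ c : ℝ, 0 < c ∧ c ^ α = a ^ α + b ^ α ∧ ∃ v : F,
    (ν.prod ν).map (fun z => a • z.1 + b • z.2) = ν.map (fun u => c • u + v)

/-- A real law is `S_α(σ, 0, 0)`: its characteristic function is `exp (-σ^α |t|^α)`. -/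
def IsSymmetricStableReal (α σ : ℝ) (ν : Measure ℝ) : Prop :=
  ∀ t : ℝ, charFun ν t = Complex.exp ((-(σ ^ α * |t| ^ α) : ℝ) : ℂ)

/-- A law `ν` on a normed space is symmetric `α`-stable: it is `α`-stable, and its image under
every continuous real-linear form is a real symmetric `α`-stable law. -/
def IsSymmetricAlphaStable {F : Type*} [NormedAddCommGroup F] [NormedSpace ℝ F]
    [MeasurableSpace F] (α : ℝ) (ν : Measure F) : Prop :=
  IsAlphaStable α ν ∧ ∀ l : F →L[ℝ] ℝ, ∃ σ : ℝ, 0 ≤ σ ∧ IsSymmetricStableReal α σ (ν.map l)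

/-! Convergence. With arrivals and marks frozen, the series is a Rademacher series `∑ ρ_k b_k x_k`
in `L^p`, where `b_k = Γ_k^{-1/α}` and `x_k = f(·, V_k)`. Khintchine's inequality at each point of
`T`, integrated over `T`, bounds the `p`-th moment of a block of the series through `∑ b_k²` and `∑
b_k^r ‖x_k‖^p`, where `r = min p 2 > α`. By the law of large numbers `Γ_k` grows at least linearly,
so `b_k^r` is dominated by the summable `k^{-r/α}`; as `E‖x_k‖^p` is finite and independent of `k`,
the required sums are almost surely finite. The partial sums form a martingale in the signs, and
Doob's maximal inequality turns the moment bound into almost sure convergence.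

Law. For a continuous linear form `l`, averaging over signs and marks shows that the characteristic
function of a partial sum is `E ∏ (1 - h(Γ_k))`, with `h(u) = E[1 - cos(θ u^{-1/α} l(x_0))]`. The
function `G(s) = exp(-∫_s^∞ h)` satisfies `G(s) = E[(1 - h(s + τ)) G(s + τ)]` for `τ` exponential,
so the product times `G` at the last arrival has constant mean `G(0)`. Since arrivals tend to
infinity and `G → 1` there, the limit is `exp(-∫_0^∞ h)`, and a change of variables makes the
integral a multiple of `|θ|^α`. All one-dimensional images are thus symmetric stable, and as the
characteristic functional determines the law, stability follows with shift `v = 0`. -/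

/-! ### Sub-Gaussian moments and Khintchine's inequality. -/

theorem Real.abs_rpow_le_mul_exp_abs {p : ℝ} (hp : 0 ≤ p) :
    ∃ K : ℝ, 0 ≤ K ∧ ∀ x : ℝ, |x| ^ p ≤ K * Real.exp |x| := by
  set n := ⌈p⌉₊
  refine ⟨1 + (n.factorial : ℝ), by positivity, fun x => ?_⟩
  have h1 : |x| ^ p ≤ 1 + |x| ^ n := by
    rcases le_total |x| 1 with h | h
    · have := Real.rpow_le_one (abs_nonneg x) h hp
      have : 0 ≤ |x| ^ n := by positivity
      linarith
    · have h2 : |x| ^ p ≤ |x| ^ (n : ℝ) := Real.rpow_le_rpow_of_exponent_le h (Nat.le_ceil p)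
      rw [Real.rpow_natCast] at h2
      linarith
  have h2 : |x| ^ n ≤ n.factorial * Real.exp |x| := by
    have := Real.pow_div_factorial_le_exp |x| (abs_nonneg x) n
    rwa [div_le_iff₀' (by positivity)] at this
  have h3 : 1 ≤ Real.exp |x| := Real.one_le_exp (abs_nonneg x)
  linarith

/-- Since `e^{|x|} ≤ e^x + e^{-x}`, the exponential moments at `±1`, each at most `e^{1/2}`, control
every power. `K` is chosen before the probability space, so it depends on `p` only. -/
theorem exists_lintegral_enorm_rpow_le_of_hasSubgaussianMGF_one {p : ℝ} (hp : 0 ≤ p) :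
    ∃ K : NNReal, ∀ {Ω : Type*} [MeasurableSpace Ω] (P : Measure Ω) (X : Ω → ℝ),
      HasSubgaussianMGF X 1 P → ∫⁻ ω, ‖X ω‖ₑ ^ p ∂P ≤ K := by
  obtain ⟨K, hK0, hK⟩ := Real.abs_rpow_le_mul_exp_abs hp
  refine ⟨(K * (2 * Real.exp (1 / 2))).toNNReal, fun {Ω} _ P X hX => ?_⟩
  have hi1 : Integrable (fun ω => Real.exp (1 * X ω)) P := hX.integrable_exp_mul 1
  have hi2 : Integrable (fun ω => Real.exp (-1 * X ω)) P := hX.integrable_exp_mul (-1)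
  have hb1 : ∫ ω, Real.exp (1 * X ω) ∂P ≤ Real.exp (1 / 2) := by simpa [mgf] using hX.mgf_le 1
  have hb2 : ∫ ω, Real.exp (-1 * X ω) ∂P ≤ Real.exp (1 / 2) := by
    simpa [mgf] using hX.mgf_le (-1)
  calc ∫⁻ ω, ‖X ω‖ₑ ^ p ∂P
      ≤ ∫⁻ ω, ENNReal.ofReal (K * (Real.exp (1 * X ω) + Real.exp (-1 * X ω))) ∂P := by
        refine lintegral_mono fun ω => ?_
        rw [← ofReal_norm, ENNReal.ofReal_rpow_of_nonneg (norm_nonneg _) hp]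
        refine ENNReal.ofReal_le_ofReal ((hK (X ω)).trans ?_)
        gcongr
        rcases abs_cases (X ω) with ⟨h, _⟩ | ⟨h, _⟩ <;> rw [h] <;> simp [Real.exp_nonneg]
    _ = ENNReal.ofReal (∫ ω, K * (Real.exp (1 * X ω) + Real.exp (-1 * X ω)) ∂P) := by
        refine (ofReal_integral_eq_lintegral_ofReal ((hi1.add hi2).const_mul K) ?_).symm
        refine Eventually.of_forall fun ω => ?_
        change 0 ≤ K * (Real.exp (1 * X ω) + Real.exp (-1 * X ω))
        positivity
    _ ≤ _ := by
        rw [integral_const_mul, integral_add hi1 hi2, ENNReal.ofReal]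
        gcongr
        linarith

/-- Dividing by `√c` reduces to parameter `1`; when `c = 0` the variable vanishes almost surely. -/
theorem exists_lintegral_enorm_rpow_le_of_hasSubgaussianMGF {p : ℝ} (hp : 0 < p) :
    ∃ K : NNReal, ∀ {Ω : Type*} [MeasurableSpace Ω] (P : Measure Ω) (X : Ω → ℝ) (c : NNReal),
      HasSubgaussianMGF X c P → ∫⁻ ω, ‖X ω‖ₑ ^ p ∂P ≤ K * (c : ℝ≥0∞) ^ (p / 2) := by
  obtain ⟨K, hK⟩ := exists_lintegral_enorm_rpow_le_of_hasSubgaussianMGF_one hp.le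
  refine ⟨K, fun {Ω} _ P X c hX => ?_⟩
  rcases eq_or_ne c 0 with rfl | hc
  · have : ∫⁻ ω, ‖X ω‖ₑ ^ p ∂P = 0 := by
      rw [lintegral_congr_ae (g := fun _ => 0)]
      · simp
      · filter_upwards [hX.ae_eq_zero_of_hasSubgaussianMGF_zero] with ω hω
        simp [hω, hp]
    simp [this]
  · set r : ℝ := Real.sqrt c with hr
    have hr0 : 0 < r := Real.sqrt_pos.2 (by positivity)
    have hr2 : r ^ 2 = c := Real.sq_sqrt (by positivity)
    have h1 : HasSubgaussianMGF (fun ω => r⁻¹ * X ω) 1 P := by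
      have := hX.const_mul r⁻¹
      convert this using 1
      ext
      change (1 : ℝ) = r⁻¹ ^ 2 * (c : ℝ)
      rw [inv_pow, hr2, inv_mul_cancel₀ (by positivity)]
    have h2 := hK P _ h1
    have h3 : ∀ ω, ‖X ω‖ₑ ^ p = (c : ℝ≥0∞) ^ (p / 2) * ‖r⁻¹ * X ω‖ₑ ^ p := by
      intro ω
      have hc' : (c : ℝ≥0∞) ^ (p / 2) = ‖r‖ₑ ^ p := by
        rw [Real.enorm_eq_ofReal hr0.le, ENNReal.ofReal_rpow_of_nonneg hr0.le hp.le,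
          ← ENNReal.ofReal_coe_nnreal, ENNReal.ofReal_rpow_of_nonneg (by positivity) (by positivity),
          ← hr2, ← Real.rpow_natCast, ← Real.rpow_mul hr0.le]
        congr 2
        push_cast; ring
      rw [hc', ← ENNReal.mul_rpow_of_nonneg _ _ hp.le, ← enorm_mul, mul_inv_cancel_left₀ hr0.ne']
    simp_rw [h3]
    rw [lintegral_const_mul' _ _ (ENNReal.rpow_ne_top_of_nonneg (by positivity) (by simp)), mul_comm]
    gcongr

/-- A sequence of independent fair random signs. -/
structure IsRademacherSeq {Ω : Type*} [MeasurableSpace Ω] (P : Measure Ω) (ρ : ℕ → Ω → ℝ) :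
    Prop where
  measurable : ∀ k, Measurable (ρ k)
  sign : ∀ k ω, ρ k ω = 1 ∨ ρ k ω = -1
  integral_eq_zero : ∀ k, ∫ ω, ρ k ω ∂P = 0
  iIndepFun : iIndepFun ρ P

namespace IsRademacherSeq

variable {Ω : Type*} [MeasurableSpace Ω] {P : Measure Ω} {ρ : ℕ → Ω → ℝ}

theorem hasSubgaussianMGF (h : IsRademacherSeq P ρ) (k : ℕ) : HasSubgaussianMGF (ρ k) 1 P := by
  have := h.iIndepFun.isProbabilityMeasure
  have h1 := hasSubgaussianMGF_of_mem_Icc_of_integral_eq_zero (μ := P) (X := ρ k) (a := -1) (b := 1)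
    (h.measurable k).aemeasurable
    (Eventually.of_forall fun ω => by rcases h.sign k ω with h | h <;> simp [h])
    (h.integral_eq_zero k)
  convert h1 using 1
  ext
  norm_num

theorem hasSubgaussianMGF_sum (h : IsRademacherSeq P ρ) (s : Finset ℕ) (a : ℕ → ℝ) :
    HasSubgaussianMGF (fun ω => ∑ k ∈ s, a k * ρ k ω) (∑ k ∈ s, ‖a k‖₊ ^ 2) P := by
  refine HasSubgaussianMGF.sum_of_iIndepFun (X := fun k ω => a k * ρ k ω)
    (h.iIndepFun.comp (fun k x => a k * x) fun k => by fun_prop) fun k _ => ?_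
  convert (h.hasSubgaussianMGF k).const_mul (a k) using 1
  ext
  change ((‖a k‖₊ ^ 2 : NNReal) : ℝ) = a k ^ 2 * 1
  simp

/-- **Khintchine's inequality** (upper bound) for complex coefficients. -/
theorem exists_lintegral_enorm_sum_rpow_le {p : ℝ} (hp : 0 < p) :
    ∃ K : NNReal, ∀ {Ω : Type*} [MeasurableSpace Ω] (P : Measure Ω) (ρ : ℕ → Ω → ℝ),
      IsRademacherSeq P ρ → ∀ (s : Finset ℕ) (z : ℕ → ℂ),
        ∫⁻ ω, ‖∑ k ∈ s, (ρ k ω : ℂ) * z k‖ₑ ^ p ∂P ≤ K * (∑ k ∈ s, ‖z k‖ₑ ^ 2) ^ (p / 2) := by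
  obtain ⟨K, hK⟩ := exists_lintegral_enorm_rpow_le_of_hasSubgaussianMGF hp
  -- `2 ^ p` comes from `‖S‖ ≤ 2 max(|Re S|, |Im S|)`, and one `K` from each of the real and
  -- imaginary parts.
  refine ⟨2 ^ p * (K + K), fun {Ω} _ P ρ h s z => ?_⟩
  have key : ∀ a : ℕ → ℝ, (∀ k, ‖a k‖ₑ ≤ ‖z k‖ₑ) →
      ∫⁻ ω, ‖∑ k ∈ s, a k * ρ k ω‖ₑ ^ p ∂P ≤ K * (∑ k ∈ s, ‖z k‖ₑ ^ 2) ^ (p / 2) := by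
    intro a ha
    refine (hK P _ _ (h.hasSubgaussianMGF_sum s a)).trans ?_
    gcongr
    push_cast
    exact Finset.sum_le_sum fun k _ => pow_le_pow_left' (ha k) 2
  have hre := key (fun k => (z k).re) fun k => by
    simpa [enorm_le_iff_norm_le] using Complex.abs_re_le_norm (z k)
  have him := key (fun k => (z k).im) fun k => by
    simpa [enorm_le_iff_norm_le] using Complex.abs_im_le_norm (z k)
  have hpt : ∀ ω, ‖∑ k ∈ s, (ρ k ω : ℂ) * z k‖ₑ ^ p ≤
      2 ^ p * (‖∑ k ∈ s, (z k).re * ρ k ω‖ₑ ^ p + ‖∑ k ∈ s, (z k).im * ρ k ω‖ₑ ^ p) := by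
    intro ω
    set S := ∑ k ∈ s, (ρ k ω : ℂ) * z k with hS
    have h1 : S.re = ∑ k ∈ s, (z k).re * ρ k ω := by simp [hS, mul_comm]
    have h2 : S.im = ∑ k ∈ s, (z k).im * ρ k ω := by simp [hS, mul_comm]
    rw [← h1, ← h2]
    have h3 : ‖S‖ₑ ≤ ‖S.re‖ₑ + ‖S.im‖ₑ := by
      rw [← ofReal_norm, ← ofReal_norm, ← ofReal_norm,
        ← ENNReal.ofReal_add (norm_nonneg _) (norm_nonneg _)]
      exact ENNReal.ofReal_le_ofReal (Complex.norm_le_abs_re_add_abs_im S)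
    have h4 : ‖S‖ₑ ≤ 2 * max ‖S.re‖ₑ ‖S.im‖ₑ := by
      refine h3.trans ?_
      rw [two_mul]
      exact add_le_add (le_max_left _ _) (le_max_right _ _)
    calc ‖S‖ₑ ^ p ≤ (2 * max ‖S.re‖ₑ ‖S.im‖ₑ) ^ p := by gcongr
      _ = 2 ^ p * (max ‖S.re‖ₑ ‖S.im‖ₑ) ^ p := ENNReal.mul_rpow_of_nonneg _ _ hp.le
      _ ≤ _ := by
        gcongr
        rcases le_total ‖S.re‖ₑ ‖S.im‖ₑ with h | h
        · rw [max_eq_right h]; exact le_add_self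
        · rw [max_eq_left h]; exact le_self_add
  have hm : ∀ k, Measurable (ρ k) := h.measurable
  calc _ ≤ _ := lintegral_mono hpt
    _ = 2 ^ p * (∫⁻ ω, ‖∑ k ∈ s, (z k).re * ρ k ω‖ₑ ^ p ∂P +
        ∫⁻ ω, ‖∑ k ∈ s, (z k).im * ρ k ω‖ₑ ^ p ∂P) := by
      rw [lintegral_const_mul _ (by fun_prop), lintegral_add_left (by fun_prop)]
    _ ≤ 2 ^ p * (K * (∑ k ∈ s, ‖z k‖ₑ ^ 2) ^ (p / 2) + K * (∑ k ∈ s, ‖z k‖ₑ ^ 2) ^ (p / 2)) := by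
      gcongr
    _ = _ := by
      rw [← add_mul, ← mul_assoc]
      push_cast [ENNReal.coe_rpow_of_nonneg _ hp.le]
      rfl

end IsRademacherSeq

/-! ### Khintchine's inequality in `L^p`. -/

theorem ENNReal.rpow_sum_le_sum_rpow {ι : Type*} (s : Finset ι) (f : ι → ℝ≥0∞) {q : ℝ}
    (hq0 : 0 < q) (hq1 : q ≤ 1) : (∑ i ∈ s, f i) ^ q ≤ ∑ i ∈ s, f i ^ q :=
  Finset.le_sum_of_subadditive (fun x : ℝ≥0∞ => x ^ q) (by simp [hq0])
    (fun x y => ENNReal.rpow_add_le_add_rpow x y hq0.le hq1) s f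

/-- For `p ≤ 2` this is subadditivity of `t^{p/2}`, and the first factor is `1`; for `p ≥ 2` it is
Hölder's inequality with weights `b_i²`. The right side is linear in the `a_i^p`, hence can be
integrated over `T` term by term. -/
theorem ENNReal.sum_mul_sq_rpow_le {ι : Type*} (s : Finset ι) (b a : ι → ℝ≥0∞) {p : ℝ}
    (hp : 0 < p) :
    (∑ i ∈ s, (b i * a i) ^ 2) ^ (p / 2) ≤
      (∑ i ∈ s, b i ^ 2) ^ max (p / 2 - 1) 0 * ∑ i ∈ s, b i ^ min p 2 * a i ^ p := by
  rcases le_total p 2 with h | h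
  · rw [max_eq_right (by linarith), min_eq_left h, ENNReal.rpow_zero, one_mul]
    refine (ENNReal.rpow_sum_le_sum_rpow s _ (by positivity) (by linarith)).trans_eq ?_
    refine Finset.sum_congr rfl fun i _ => ?_
    rw [← ENNReal.rpow_natCast, ← ENNReal.rpow_mul, ENNReal.mul_rpow_of_nonneg _ _ (by positivity)]
    congr 2 <;> push_cast <;> ring
  · rw [max_eq_left (by linarith), min_eq_right h]
    have h1 := ENNReal.inner_le_weight_mul_Lp_of_nonneg s (p := p / 2) (by linarith)
      (fun i => b i ^ 2) (fun i => a i ^ 2)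
    simp_rw [← mul_pow] at h1
    calc (∑ i ∈ s, (b i * a i) ^ 2) ^ (p / 2) ≤ _ := ENNReal.rpow_le_rpow h1 (by positivity)
      _ = _ := by
        rw [ENNReal.mul_rpow_of_nonneg _ _ (by positivity), ← ENNReal.rpow_mul, ← ENNReal.rpow_mul]
        congr 1
        · congr 1
          field_simp
        · rw [inv_mul_cancel₀ (by positivity), ENNReal.rpow_one]
          refine Finset.sum_congr rfl fun i _ => ?_
          congr 1
          · rw [← ENNReal.rpow_natCast]; norm_num
          · rw [← ENNReal.rpow_natCast, ← ENNReal.rpow_mul]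
            congr 1
            push_cast; ring

theorem Lp.enorm_rpow_eq_lintegral {X F : Type*} [MeasurableSpace X] [NormedAddCommGroup F]
    {μ : Measure X} {p : ℝ≥0∞} (hp0 : p ≠ 0) (hp : p ≠ ∞) (g : Lp F p μ) :
    ‖g‖ₑ ^ p.toReal = ∫⁻ x, ‖g x‖ₑ ^ p.toReal ∂μ := by
  rw [Lp.enorm_def, eLpNorm_eq_lintegral_rpow_enorm_toReal hp0 hp, ← ENNReal.rpow_mul,
    one_div_mul_cancel (ENNReal.toReal_pos hp0 hp).ne', ENNReal.rpow_one]

theorem Lp.coeFn_finset_sum_smul_ae {X : Type*} [MeasurableSpace X]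
    {μ : Measure X} {p : ℝ≥0∞} (s : Finset ℕ) (a : ℕ → ℝ) (x : ℕ → Lp ℂ p μ) :
    ⇑(∑ k ∈ s, a k • x k) =ᵐ[μ] fun t => ∑ k ∈ s, (a k : ℂ) * x k t := by
  classical
  induction s using Finset.induction_on with
  | empty =>
    simp only [Finset.sum_empty]
    exact Lp.coeFn_zero ℂ p μ
  | insert k s hk ih =>
    rw [Finset.sum_insert hk]
    filter_upwards [Lp.coeFn_add (a k • x k) (∑ k ∈ s, a k • x k), ih, Lp.coeFn_smul (a k) (x k)]
      with t h1 h2 h3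
    rw [h1, Pi.add_apply, h2, h3, Finset.sum_insert hk]
    simp

/-- The `p`-th power of the norm is an integral, so Tonelli's theorem reduces the claim to the
scalar inequality with coefficients `b_k x_k(t)`, at each fixed `t`. -/
theorem IsRademacherSeq.exists_lintegral_enorm_sum_smul_rpow_le {p : ℝ≥0∞} (hp0 : p ≠ 0)
    (hp : p ≠ ∞) :
    ∃ K : NNReal, ∀ {Ω : Type*} [MeasurableSpace Ω] (P : Measure Ω) (ρ : ℕ → Ω → ℝ),
      IsRademacherSeq P ρ → ∀ {X : Type*} [MeasurableSpace X] (μ : Measure X) [SFinite μ]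
        [Fact (1 ≤ p)] (s : Finset ℕ) (b : ℕ → ℝ) (x : ℕ → Lp ℂ p μ),
        ∫⁻ ω, ‖∑ k ∈ s, ρ k ω • b k • x k‖ₑ ^ p.toReal ∂P ≤
          K * (∑ k ∈ s, ‖b k‖ₑ ^ 2) ^ max (p.toReal / 2 - 1) 0 *
            ∑ k ∈ s, ‖b k‖ₑ ^ min p.toReal 2 * ‖x k‖ₑ ^ p.toReal := by
  have hp' : 0 < p.toReal := ENNReal.toReal_pos hp0 hp
  obtain ⟨K, hK⟩ := IsRademacherSeq.exists_lintegral_enorm_sum_rpow_le hp'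
  refine ⟨K, fun {Ω} _ P ρ h {X} _ μ _ _ s b x => ?_⟩
  have := h.iIndepFun.isProbabilityMeasure
  have hm : ∀ k, Measurable (ρ k) := h.measurable
  have hx : ∀ k, Measurable (x k) := fun k => (Lp.stronglyMeasurable (x k)).measurable
  have h1 : ∀ ω, ‖∑ k ∈ s, ρ k ω • b k • x k‖ₑ ^ p.toReal =
      ∫⁻ t, ‖∑ k ∈ s, (ρ k ω : ℂ) * (b k * x k t)‖ₑ ^ p.toReal ∂μ := by
    intro ω
    rw [Lp.enorm_rpow_eq_lintegral hp0 hp]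
    simp_rw [smul_smul]
    refine lintegral_congr_ae ?_
    filter_upwards [Lp.coeFn_finset_sum_smul_ae s (fun k => ρ k ω * b k) x] with t ht
    rw [ht]
    simp only [Complex.ofReal_mul, mul_assoc]
  simp_rw [h1]
  rw [lintegral_lintegral_swap (by
    refine Measurable.aemeasurable ?_
    refine Measurable.pow_const (Measurable.enorm ?_) _
    refine Finset.measurable_sum _ fun k _ => ?_
    exact (Complex.measurable_ofReal.comp ((hm k).comp measurable_fst)).mul
      (((hx k).comp measurable_snd).const_mul _))]
  calc ∫⁻ t, ∫⁻ ω, ‖∑ k ∈ s, (ρ k ω : ℂ) * (b k * x k t)‖ₑ ^ p.toReal ∂P ∂μ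
      ≤ ∫⁻ t, K * (∑ k ∈ s, ‖b k‖ₑ ^ 2) ^ max (p.toReal / 2 - 1) 0 *
          ∑ k ∈ s, ‖b k‖ₑ ^ min p.toReal 2 * ‖x k t‖ₑ ^ p.toReal ∂μ := by
        refine lintegral_mono fun t => (hK P ρ h s _).trans ?_
        rw [mul_assoc]
        gcongr
        refine le_trans (le_of_eq ?_) (ENNReal.sum_mul_sq_rpow_le s (fun k => ‖b k‖ₑ) (fun k => ‖x k t‖ₑ) hp')
        have hb : ∀ k, ‖(b k : ℂ)‖ₑ = ‖b k‖ₑ := fun k => by simp [← ofReal_norm]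
        simp [enorm_mul, hb]
    _ = _ := by
        rw [lintegral_const_mul _ (by fun_prop), lintegral_finsetSum _ (fun k _ => by fun_prop)]
        congr 1
        refine Finset.sum_congr rfl fun k _ => ?_
        rw [lintegral_const_mul _ (by fun_prop), Lp.enorm_rpow_eq_lintegral hp0 hp]

/-! ### Maximal inequality and almost sure convergence of Rademacher series. -/

/-- Conditional Jensen for the norm, along the filtration shifted by `m`, for which `M m` is already
known at time `0`. -/
theorem MeasureTheory.Martingale.submartingale_norm_sub {Ω F : Type*} {m0 : MeasurableSpace Ω}
    {P : Measure Ω} [IsFiniteMeasure P] [NormedAddCommGroup F] [NormedSpace ℝ F] [CompleteSpace F]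
    {𝒢 : Filtration ℕ m0} {M : ℕ → Ω → F} (hM : Martingale M 𝒢 P) (m : ℕ) :
    ∃ 𝒢' : Filtration ℕ m0, Submartingale (fun k ω => ‖M (m + k) ω - M m ω‖) 𝒢' P := by
  refine ⟨⟨fun k => 𝒢 (m + k), fun i j hij => 𝒢.mono (by omega), fun i => 𝒢.le _⟩, ?_, ?_, ?_⟩
  · intro k
    exact ((hM.stronglyMeasurable (m + k)).sub
      ((hM.stronglyMeasurable m).mono (𝒢.mono (by omega)))).norm
  · intro i j hij
    have h1 := norm_condExp_le (μ := P) (m := 𝒢 (m + i)) (fun ω => M (m + j) ω - M m ω)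
    have h2 : P[fun ω => M (m + j) ω - M m ω | 𝒢 (m + i)] =ᵐ[P] fun ω => M (m + i) ω - M m ω := by
      refine (condExp_sub (hM.integrable _) (hM.integrable _) _).trans ?_
      have h3 := hM.condExp_ae_eq (i := m + i) (j := m + j) (by omega)
      have h4 : P[M m | 𝒢 (m + i)] = M m := condExp_of_stronglyMeasurable (𝒢.le _)
        ((hM.stronglyMeasurable m).mono (𝒢.mono (by omega))) (hM.integrable m)
      filter_upwards [h3] with ω h3
      simp [h3, h4]
    filter_upwards [h1, h2] with ω h1 h2
    rw [h2] at h1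
    exact h1
  · intro k
    exact ((hM.integrable _).sub (hM.integrable _)).norm

/-- Doob's maximal inequality bounds the probability that some increment after time `m` reaches `ε`
by `δ m / ε`. -/
theorem MeasureTheory.Martingale.ae_cauchySeq_of_lintegral_enorm_sub_le {Ω F : Type*}
    {m0 : MeasurableSpace Ω}
    {P : Measure Ω} [IsFiniteMeasure P] [NormedAddCommGroup F] [NormedSpace ℝ F] [CompleteSpace F]
    {𝒢 : Filtration ℕ m0} {M : ℕ → Ω → F} (hM : Martingale M 𝒢 P) {δ : ℕ → ℝ≥0∞}
    (hδ : Tendsto δ atTop (𝓝 0)) (hMδ : ∀ m k, ∫⁻ ω, ‖M (m + k) ω - M m ω‖ₑ ∂P ≤ δ m) :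
    ∀ᵐ ω ∂P, CauchySeq fun n => M n ω := by
  have key : ∀ (ε : NNReal) (m : ℕ), ε * P {ω | ∃ k, (ε : ℝ) ≤ ‖M (m + k) ω - M m ω‖} ≤ δ m := by
    intro ε m
    obtain ⟨𝒢', hs⟩ := hM.submartingale_norm_sub m
    have h1 : {ω | ∃ k, (ε : ℝ) ≤ ‖M (m + k) ω - M m ω‖} =
        ⋃ n : ℕ, {ω | ∃ k ≤ n, (ε : ℝ) ≤ ‖M (m + k) ω - M m ω‖} := by
      ext ω
      simp only [Set.mem_ofPred_eq, Set.mem_iUnion]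
      exact ⟨fun ⟨k, hk⟩ => ⟨k, k, le_rfl, hk⟩, fun ⟨_, k, _, hk⟩ => ⟨k, hk⟩⟩
    rw [h1, Monotone.measure_iUnion (by
      rintro i j hij ω ⟨k, hk, h⟩
      exact ⟨k, hk.trans hij, h⟩),
      ENNReal.mul_iSup]
    refine iSup_le fun n => ?_
    have h2 := maximal_ineq hs (fun k ω => norm_nonneg _) (ε := ε) n
    calc _ ≤ _ := by
          gcongr
          rintro ⟨k, hk, h⟩
          refine h.trans ?_
          exact Finset.le_sup' (fun k => ‖M (m + k) ω - M m ω‖) (Finset.mem_range.2 (by omega))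
      _ ≤ _ := h2
      _ ≤ ENNReal.ofReal (∫ ω, ‖M (m + n) ω - M m ω‖ ∂P) := by
          refine ENNReal.ofReal_le_ofReal (setIntegral_le_integral (hs.integrable n) ?_)
          exact Eventually.of_forall fun ω => norm_nonneg _
      _ = ∫⁻ ω, ‖M (m + n) ω - M m ω‖ₑ ∂P :=
          ofReal_integral_norm_eq_lintegral_enorm ((hM.integrable _).sub (hM.integrable _))
      _ ≤ δ m := hMδ m n
  have h3 : ∀ j : ℕ, ∀ᵐ ω ∂P, ∃ m, ∀ k, ‖M (m + k) ω - M m ω‖ < 1 / ((j : ℝ) + 1) := by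
    intro j
    set ε : NNReal := 1 / ((j : NNReal) + 1) with hε
    have hε0 : ε ≠ 0 := by positivity
    rw [ae_iff]
    -- The bad event does not depend on `m` and lies in the event of `key` for every `m`, so its
    -- probability is bounded by a sequence tending to `0`.
    have h4 : ∀ m, (ε : ℝ≥0∞) * P {ω | ¬∃ m, ∀ k, ‖M (m + k) ω - M m ω‖ < 1 / ((j : ℝ) + 1)} ≤ δ m := by
      intro m
      refine le_trans ?_ (key ε m)
      gcongr
      intro hω
      push Not at hω
      obtain ⟨k, hk⟩ := hω m
      exact ⟨k, by simpa [hε] using hk⟩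
    have h5 := ge_of_tendsto' hδ h4
    simpa [hε0] using h5
  filter_upwards [ae_all_iff.2 h3] with ω hω
  rw [Metric.cauchySeq_iff']
  intro ε hε
  obtain ⟨j, hj⟩ := exists_nat_one_div_lt hε
  obtain ⟨m, hm⟩ := hω j
  refine ⟨m, fun n hn => ?_⟩
  have := hm (n - m)
  rw [Nat.add_sub_cancel' hn] at this
  rw [dist_eq_norm]
  exact this.trans hj

/-- The natural filtration at time `n` contains `ρ n`, hence the sum over `range (n + 1)`: the next
increment involves only `ρ (n + 1)`, which is centred and independent of the past. -/
theorem IsRademacherSeq.martingale_sum_smul {Ω F : Type*} [MeasurableSpace Ω] {P : Measure Ω}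
    {ρ : ℕ → Ω → ℝ} (h : IsRademacherSeq P ρ) [NormedAddCommGroup F] [NormedSpace ℝ F]
    [CompleteSpace F] (w : ℕ → F) :
    Martingale (fun n ω => ∑ k ∈ Finset.range (n + 1), ρ k ω • w k)
      (Filtration.natural ρ fun k => (h.measurable k).stronglyMeasurable) P := by
  have := h.iIndepFun.isProbabilityMeasure
  have hsm : ∀ k, StronglyMeasurable (ρ k) := fun k => (h.measurable k).stronglyMeasurable
  have hint : ∀ k, Integrable (fun ω => ρ k ω • w k) P := fun k =>
    (h.hasSubgaussianMGF k).integrable.smul_const _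
  refine martingale_of_condExp_sub_eq_zero_nat (fun n => ?_)
    (fun n => integrable_finsetSum _ fun k _ => hint k) fun n => ?_
  · refine Finset.stronglyMeasurable_fun_sum _ fun k hk => ?_
    refine StronglyMeasurable.smul_const ?_ _
    exact (Filtration.stronglyAdapted_natural hsm k).mono
      ((Filtration.natural ρ hsm).mono (by simpa [Nat.lt_succ_iff] using hk))
  · have h1 : (fun ω => ∑ k ∈ Finset.range (n + 1 + 1), ρ k ω • w k) -
        (fun ω => ∑ k ∈ Finset.range (n + 1), ρ k ω • w k) = fun ω => ρ (n + 1) ω • w (n + 1) := by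
      ext ω
      simp [Finset.sum_range_succ _ (n + 1)]
    rw [h1]
    refine (condExp_indep_eq (h.measurable (n + 1)).comap_le (Filtration.le _ _)
      ((comap_measurable (ρ (n + 1))).stronglyMeasurable.smul_const _)
      (h.iIndepFun.indep_comap_natural_of_lt hsm (Nat.lt_succ_self n))).trans ?_
    rw [integral_smul_const, h.integral_eq_zero, zero_smul]
    rfl

theorem lintegral_enorm_le_lintegral_rpow_enorm {Ω F : Type*} [MeasurableSpace Ω] {P : Measure Ω}
    [IsProbabilityMeasure P] [NormedAddCommGroup F] {X : Ω → F} (hX : AEStronglyMeasurable X P)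
    {p : ℝ≥0∞} (hp1 : 1 ≤ p) (hp : p ≠ ∞) :
    ∫⁻ ω, ‖X ω‖ₑ ∂P ≤ (∫⁻ ω, ‖X ω‖ₑ ^ p.toReal ∂P) ^ (1 / p.toReal) := by
  have h := eLpNorm_le_eLpNorm_of_exponent_le hp1 hX
  rwa [eLpNorm_one_eq_lintegral_enorm,
    eLpNorm_eq_lintegral_rpow_enorm_toReal (zero_lt_one.trans_le hp1).ne' hp] at h

/-- Almost sure convergence of Rademacher series in `L^p`. -/
theorem IsRademacherSeq.ae_cauchySeq_sum_smul {Ω : Type*} [MeasurableSpace Ω] {P : Measure Ω}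
    {ρ : ℕ → Ω → ℝ} (h : IsRademacherSeq P ρ) {X : Type*} [MeasurableSpace X] {μ : Measure X}
    [SFinite μ] {p : ℝ≥0∞} [hp1 : Fact (1 ≤ p)] (hp : p ≠ ∞) (b : ℕ → ℝ) (x : ℕ → Lp ℂ p μ)
    (hb : ∑' k, ‖b k‖ₑ ^ min p.toReal 2 ≠ ∞)
    (hbx : ∑' k, ‖b k‖ₑ ^ min p.toReal 2 * ‖x k‖ₑ ^ p.toReal ≠ ∞) :
    ∀ᵐ ω ∂P, CauchySeq fun N => ∑ k ∈ Finset.range N, ρ k ω • b k • x k := by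
  have := h.iIndepFun.isProbabilityMeasure
  have hp0 : p ≠ 0 := (zero_lt_one.trans_le hp1.out).ne'
  have hp' : 0 < p.toReal := ENNReal.toReal_pos hp0 hp
  obtain ⟨K, hK⟩ := IsRademacherSeq.exists_lintegral_enorm_sum_smul_rpow_le hp0 hp
  set g : ℕ → ℝ≥0∞ := fun k => ‖b k‖ₑ ^ min p.toReal 2 * ‖x k‖ₑ ^ p.toReal with hg
  set B : ℝ≥0∞ := (∑' k, ‖b k‖ₑ ^ 2) ^ max (p.toReal / 2 - 1) 0 with hB
  -- For `p ≤ 2` the exponent is `0` and `B = 1` whatever the sum; for `p ≥ 2` the sum is the one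
  -- assumed finite in `hb`.
  have hBtop : B ≠ ∞ := by
    rcases le_total p.toReal 2 with h2 | h2
    · rw [hB, max_eq_right (by linarith)]
      simp
    · rw [min_eq_right h2] at hb
      refine ENNReal.rpow_ne_top_of_nonneg (le_max_right _ _) ?_
      convert hb using 4
      rw [← ENNReal.rpow_natCast]
      norm_num
  have hM := h.martingale_sum_smul (fun k => b k • x k)
  have hδ : Tendsto (fun m => (K * B * ∑' k, g (k + (m + 1))) ^ (1 / p.toReal)) atTop (𝓝 0) := by
    have h1 := (tendsto_add_atTop_iff_nat 1).2 (ENNReal.tendsto_sum_nat_add g hbx)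
    have h2 := ENNReal.Tendsto.const_mul (a := K * B) h1
      (Or.inr (ENNReal.mul_ne_top (by simp) hBtop))
    rw [mul_zero] at h2
    have h3 := h2.ennrpow_const (1 / p.toReal)
    rwa [ENNReal.zero_rpow_of_pos (by positivity)] at h3
  have hcs := hM.ae_cauchySeq_of_lintegral_enorm_sub_le hδ fun m k => by
    refine (lintegral_enorm_le_lintegral_rpow_enorm (p := p)
      ((hM.integrable _).sub (hM.integrable _)).aestronglyMeasurable hp1.out hp).trans ?_
    refine ENNReal.rpow_le_rpow ?_ (by positivity)
    have h1 : ∀ ω, (∑ i ∈ Finset.range (m + k + 1), ρ i ω • b i • x i) -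
        ∑ i ∈ Finset.range (m + 1), ρ i ω • b i • x i =
        ∑ i ∈ Finset.Ico (m + 1) (m + k + 1), ρ i ω • b i • x i := fun ω =>
      (Finset.sum_Ico_eq_sub _ (by omega)).symm
    refine (lintegral_congr fun ω => congrArg (fun y => ‖y‖ₑ ^ p.toReal) (h1 ω)).trans_le ?_
    refine (hK P ρ h μ _ b x).trans ?_
    gcongr
    · exact ENNReal.rpow_le_rpow (ENNReal.sum_le_tsum _) (le_max_right _ _)
    · rw [Finset.sum_Ico_eq_sum_range]
      exact (ENNReal.sum_le_tsum (f := fun i => g (m + 1 + i)) _).trans_eq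
        (tsum_congr fun i => by rw [add_comm])
  filter_upwards [hcs] with ω hω
  exact (cauchySeq_shift 1).1 hω

/-! ### The exponential law and the renewal identity. -/

theorem expMeasure_one_eq_withDensity :
    expMeasure 1 = (volume.restrict (Set.Ioi 0)).withDensity
      fun x => ENNReal.ofReal (Real.exp (-x)) := by
  have h : expMeasure 1 = volume.withDensity (exponentialPDF 1) := rfl
  rw [h, ← withDensity_indicator measurableSet_Ioi]
  refine withDensity_congr_ae ?_
  filter_upwards [compl_mem_ae_iff.2 (measure_singleton (μ := volume) (0 : ℝ))] with x hx
  rw [exponentialPDF_eq, Set.indicator_apply]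
  have hx0 : x ≠ 0 := hx
  rcases lt_or_gt_of_ne hx0 with h | h
  · simp [h.not_ge, h.not_gt]
  · simp [h, h.le]

theorem ae_pos_expMeasure_one : ∀ᵐ x ∂(expMeasure 1), 0 < x := by
  rw [expMeasure_one_eq_withDensity]
  exact (withDensity_absolutelyContinuous _ _).ae_le (ae_restrict_mem measurableSet_Ioi)

theorem integral_expMeasure_one (g : ℝ → ℝ) :
    ∫ x, g x ∂(expMeasure 1) = ∫ x in Set.Ioi 0, Real.exp (-x) * g x := by
  rw [expMeasure_one_eq_withDensity, integral_withDensity_eq_integral_toReal_smul (by fun_prop)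
    (by simp)]
  simp [ENNReal.toReal_ofReal (Real.exp_nonneg _)]

/-- `exp (-∫_s^∞ h)`. -/
noncomputable def expNegTail (h : ℝ → ℝ) (s : ℝ) : ℝ :=
  Real.exp (-∫ u in Set.Ioi s, h u)

section expNegTail

variable {h : ℝ → ℝ}

theorem expNegTail_pos (s : ℝ) : 0 < expNegTail h s := Real.exp_pos _

theorem expNegTail_le_one (h0 : ∀ u, 0 ≤ h u) (s : ℝ) : expNegTail h s ≤ 1 := by
  rw [expNegTail, Real.exp_le_one_iff, neg_nonpos]
  exact integral_nonneg h0

theorem expNegTail_eq (hi : Integrable h) :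
    expNegTail h = fun s => Real.exp ((∫ u in (0 : ℝ)..s, h u) - ∫ u in Set.Ioi 0, h u) := by
  ext s
  rw [expNegTail, ← intervalIntegral.integral_interval_add_Ioi (a := 0) (b := s)
    hi.integrableOn hi.integrableOn]
  ring_nf

theorem continuous_expNegTail (hi : Integrable h) : Continuous (expNegTail h) := by
  rw [expNegTail_eq hi]
  have := hi.continuous_primitive 0
  fun_prop

theorem tendsto_expNegTail (hi : Integrable h) : Tendsto (expNegTail h) atTop (𝓝 1) := by
  have h1 : (1 : ℝ) = Real.exp ((∫ u in Set.Ioi 0, h u) - ∫ u in Set.Ioi 0, h u) := by simp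
  rw [expNegTail_eq hi, h1]
  exact (Real.continuous_exp.tendsto _).comp
    ((intervalIntegral_tendsto_integral_Ioi 0 hi.integrableOn tendsto_id).sub_const _)

theorem hasDerivAt_expNegTail (hi : Integrable h) (hc : ContinuousOn h (Set.Ioi 0)) {s : ℝ}
    (hs : 0 < s) : HasDerivAt (expNegTail h) (expNegTail h s * h s) s := by
  have h1 : HasDerivAt (fun s => ∫ u in (0 : ℝ)..s, h u) (h s) s :=
    intervalIntegral.integral_hasDerivAt_right hi.intervalIntegrable
      hi.aestronglyMeasurable.stronglyMeasurableAtFilter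
      (hc.continuousAt (Ioi_mem_nhds hs))
  have h2 := (h1.sub_const (∫ u in Set.Ioi 0, h u)).exp
  rw [expNegTail_eq hi]
  exact h2

/-- The renewal identity satisfied by `expNegTail h`. -/
theorem integral_expMeasure_expNegTail (hi : Integrable h) (hm : Measurable h)
    (hc : ContinuousOn h (Set.Ioi 0))
    (h0 : ∀ u, 0 ≤ h u) (h2 : ∀ u, h u ≤ 2) {s : ℝ} (hs : 0 ≤ s) :
    ∫ x, (1 - h (s + x)) * expNegTail h (s + x) ∂(expMeasure 1) = expNegTail h s := by
  rw [integral_expMeasure_one]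
  have hcont := continuous_expNegTail hi
  -- As `G' = h G` for `G = expNegTail h`, the integrand has the primitive `-e^{-x} G(s + x)`, equal
  -- to `-G(s)` at `0` and tending to `0` at infinity.
  have hd : ∀ x ∈ Set.Ioi (0 : ℝ), HasDerivAt (fun x => -(Real.exp (-x) * expNegTail h (s + x)))
      (Real.exp (-x) * ((1 - h (s + x)) * expNegTail h (s + x))) x := by
    intro x hx
    have h3 := (hasDerivAt_expNegTail hi hc (s := s + x) (add_pos_of_nonneg_of_pos hs hx)).comp_const_add s x
    have h4 := ((hasDerivAt_neg x).exp.mul h3).neg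
    exact h4.congr_deriv (by ring)
  rw [integral_Ioi_of_hasDerivAt_of_tendsto (m := 0) (by fun_prop) hd]
  · simp
  · refine Integrable.mono' (g := fun x => Real.exp (-x)) ?_ ?_ ?_
    · exact integrableOn_exp_neg_Ioi 0
    · exact Measurable.aestronglyMeasurable (by fun_prop)
    · refine Eventually.of_forall fun x => ?_
      have h5 := (expNegTail_pos (h := h) (s + x)).le
      have h6 := expNegTail_le_one h0 (s + x)
      have h7 : |1 - h (s + x)| ≤ 1 := by
        rw [abs_le]; constructor <;> linarith [h0 (s + x), h2 (s + x)]
      rw [norm_mul, norm_mul, Real.norm_of_nonneg (Real.exp_nonneg _), Real.norm_of_nonneg h5,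
        Real.norm_eq_abs]
      calc _ ≤ Real.exp (-x) * (1 * 1) := by gcongr
        _ = _ := by simp
  · have h1 : Tendsto (fun x => -(Real.exp (-x) * expNegTail h (s + x))) atTop (𝓝 (-(0 * 1))) :=
      ((Real.tendsto_exp_neg_atTop_nhds_zero).mul
        ((tendsto_expNegTail hi).comp (tendsto_atTop_add_const_left _ s tendsto_id))).neg
    simpa using h1

end expNegTail

theorem ProbabilityTheory.IndepFun.integral_fun_prodMk {Ω β γ F : Type*} [MeasurableSpace Ω]
    [MeasurableSpace β] [MeasurableSpace γ] [NormedAddCommGroup F] [NormedSpace ℝ F]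
    {P : Measure Ω} [IsFiniteMeasure P] {Y : Ω → β} {Z : Ω → γ} (hYZ : IndepFun Y Z P)
    (hY : Measurable Y) (hZ : Measurable Z) {g : β × γ → F} (hg : StronglyMeasurable g)
    (hi : Integrable (fun ω => g (Y ω, Z ω)) P) :
    ∫ ω, g (Y ω, Z ω) ∂P = ∫ ω, ∫ z, g (Y ω, z) ∂(P.map Z) ∂P := by
  have hmap := (indepFun_iff_map_prod_eq_prod_map_map hY.aemeasurable hZ.aemeasurable).1 hYZ
  have h1 : ∫ ω, g (Y ω, Z ω) ∂P = ∫ q, g q ∂(P.map fun ω => (Y ω, Z ω)) :=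
    (integral_map (hY.prodMk hZ).aemeasurable hg.aestronglyMeasurable).symm
  have h2 : Integrable g ((P.map Y).prod (P.map Z)) := by
    rw [← hmap]
    exact (integrable_map_measure hg.aestronglyMeasurable (hY.prodMk hZ).aemeasurable).2 hi
  rw [h1, hmap, integral_prod _ h2, integral_map hY.aemeasurable]
  exact (StronglyMeasurable.integral_prod_right (f := fun y z => g (y, z)) hg).aestronglyMeasurable

theorem ProbabilityTheory.IndepFun.ae_of_ae_ae {Ω β γ : Type*} [MeasurableSpace Ω]
    [MeasurableSpace β] [MeasurableSpace γ]
    {P : Measure Ω} [IsFiniteMeasure P] {Y : Ω → β} {Z : Ω → γ} (hYZ : IndepFun Y Z P)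
    (hY : Measurable Y) (hZ : Measurable Z) {s : Set (β × γ)} (hs : MeasurableSet s)
    (h : ∀ᵐ ω ∂P, ∀ᵐ ω' ∂P, (Y ω, Z ω') ∈ s) : ∀ᵐ ω ∂P, (Y ω, Z ω) ∈ s := by
  have hmap := (indepFun_iff_map_prod_eq_prod_map_map hY.aemeasurable hZ.aemeasurable).1 hYZ
  have h1 : ∀ᵐ q ∂(P.map fun ω => (Y ω, Z ω)), q ∈ s := by
    rw [hmap, Measure.ae_prod_iff_ae_ae (p := (· ∈ s)) hs, ae_map_iff hY.aemeasurable]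
    · filter_upwards [h] with ω hω
      rw [ae_map_iff hZ.aemeasurable (measurable_prodMk_left hs)]
      exact hω
    · exact measurable_measure_prodMk_left (ν := P.map Z) hs.compl (measurableSet_singleton 0)
  exact ae_of_ae_map (hY.prodMk hZ).aemeasurable h1

/-! ### Growth and generating functional of the Poisson arrival times. -/

section PoissonArrivals

variable {Ω : Type*} [MeasurableSpace Ω] {P : Measure Ω} {τ : ℕ → Ω → ℝ}

theorem ae_pos_of_map_eq_expMeasure (hm : ∀ j, Measurable (τ j))
    (hl : ∀ j, P.map (τ j) = expMeasure 1) : ∀ᵐ ω ∂P, ∀ j, 0 < τ j ω := by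
  refine ae_all_iff.2 fun j => ae_of_ae_map (hm j).aemeasurable ?_
  rw [hl j]
  exact ae_pos_expMeasure_one

/-- The strong law is applied to the bounded variables `min τ_j 1`, so integrability is immediate;
`c` is half their positive mean. -/
theorem exists_eventually_mul_le_sum_of_exp (hm : ∀ j, Measurable (τ j))
    (hl : ∀ j, P.map (τ j) = expMeasure 1) (hi : iIndepFun τ P) :
    ∃ c : ℝ, 0 < c ∧ ∀ᵐ ω ∂P, ∀ᶠ n : ℕ in atTop, c * n ≤ ∑ j ∈ Finset.range n, τ j ω := by
  have := hi.isProbabilityMeasure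
  have hpos := ae_pos_of_map_eq_expMeasure hm hl
  set X : ℕ → Ω → ℝ := fun j ω => min (τ j ω) 1 with hX
  have hint : Integrable (X 0) P := by
    refine Integrable.of_bound (C := 1) (by fun_prop) ?_
    filter_upwards [hpos] with ω hω
    rw [Real.norm_of_nonneg (le_min (hω 0).le zero_le_one)]
    exact min_le_right _ _
  have hindep : Pairwise fun i j => IndepFun (X i) (X j) P := fun i j hij =>
    (hi.indepFun hij).comp (measurable_id.min measurable_const) (measurable_id.min measurable_const)
  have hident : ∀ i, IdentDistrib (X i) (X 0) P P := fun i =>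
    (IdentDistrib.mk (hm i).aemeasurable (hm 0).aemeasurable (by rw [hl, hl])).comp
      (u := fun x => min x 1) (measurable_id.min measurable_const)
  have hmean : 0 < ∫ ω, X 0 ω ∂P := by
    rw [integral_pos_iff_support_of_nonneg_ae _ hint]
    · rw [pos_iff_ne_zero]
      intro h0
      have h1 : ∀ᵐ ω ∂P, X 0 ω = 0 := h0
      obtain ⟨ω, hω, hω'⟩ := (h1.and hpos).exists
      exact (lt_min (hω' 0) zero_lt_one).ne' hω
    · filter_upwards [hpos] with ω hω
      exact le_min (hω 0).le zero_le_one
  refine ⟨(∫ ω, X 0 ω ∂P) / 2, by positivity, ?_⟩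
  filter_upwards [strong_law_ae_real X hint hindep hident] with ω h
  filter_upwards [h.eventually (lt_mem_nhds (half_lt_self hmean)), eventually_gt_atTop 0]
    with n hn hn0
  rw [lt_div_iff₀ (by positivity)] at hn
  exact hn.le.trans (Finset.sum_le_sum fun j _ => min_le_left _ _)

/-- The mean does not change from `n` to `n + 1`: `τ n` is independent of the earlier waiting times,
and integrating it out is the renewal identity at `s = A_n`, the sum of the first `n` waiting times.
-/
theorem integral_prod_mul_expNegTail (hm : ∀ j, Measurable (τ j))
    (hl : ∀ j, P.map (τ j) = expMeasure 1) (hi : iIndepFun τ P) {h : ℝ → ℝ}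
    (hint : Integrable h) (hhm : Measurable h) (hc : ContinuousOn h (Set.Ioi 0))
    (h0 : ∀ u, 0 ≤ h u) (h2 : ∀ u, h u ≤ 2) (n : ℕ) :
    ∫ ω, (∏ k ∈ Finset.range n, (1 - h (∑ j ∈ Finset.range (k + 1), τ j ω))) *
      expNegTail h (∑ j ∈ Finset.range n, τ j ω) ∂P = expNegTail h 0 := by
  have := hi.isProbabilityMeasure
  have hpos := ae_pos_of_map_eq_expMeasure hm hl
  have h1 : ∀ u, |1 - h u| ≤ 1 := fun u => by
    rw [abs_le]; constructor <;> linarith [h0 u, h2 u]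
  have hG : Measurable (expNegTail h) := (continuous_expNegTail hint).measurable
  induction n with
  | zero => simp
  | succ n ih =>
    rw [← ih]
    set Y : Ω → ℝ × ℝ := fun ω =>
      (∏ k ∈ Finset.range n, (1 - h (∑ j ∈ Finset.range (k + 1), τ j ω)),
        ∑ j ∈ Finset.range n, τ j ω) with hY
    have hYm : Measurable Y := by fun_prop
    have hYτ : IndepFun Y (τ n) P := by
      have h3 := hi.indepFun_finset (Finset.range n) {n} (by simp) hm
      -- `Y` is written as a measurable function of the first `n` waiting times; the padding by `0`
      -- is never read.
      let φ : (Finset.range n → ℝ) → ℝ × ℝ := fun x =>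
        let t : ℕ → ℝ := fun j => if hj : j ∈ Finset.range n then x ⟨j, hj⟩ else 0
        (∏ k ∈ Finset.range n, (1 - h (∑ j ∈ Finset.range (k + 1), t j)),
          ∑ j ∈ Finset.range n, t j)
      have ht : ∀ j, Measurable fun x : Finset.range n → ℝ =>
          if hj : j ∈ Finset.range n then x ⟨j, hj⟩ else 0 := by
        intro j
        split_ifs with hj
        · exact measurable_pi_apply _
        · exact measurable_const
      have hφ : Measurable φ := by fun_prop
      have h4 := h3.comp hφ (measurable_pi_apply (⟨n, by simp⟩ : ({n} : Finset ℕ)))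
      suffices e : Y = φ ∘ fun ω (i : Finset.range n) => τ i ω by rw [e]; exact h4
      ext ω
      · simp only [hY, φ, Function.comp_apply]
        refine Finset.prod_congr rfl fun k hk => ?_
        congr 2
        refine Finset.sum_congr rfl fun j hj => ?_
        rw [dif_pos]
        simp only [Finset.mem_range] at hk hj ⊢
        omega
      · simp only [hY, φ, Function.comp_apply]
        refine Finset.sum_congr rfl fun j hj => ?_
        rw [dif_pos hj]
    set g : (ℝ × ℝ) × ℝ → ℝ := fun q => q.1.1 * ((1 - h (q.1.2 + q.2)) * expNegTail h (q.1.2 + q.2))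
      with hg
    have hgm : Measurable g := by fun_prop
    have hprod : ∀ ω, |(Y ω).1| ≤ 1 := fun ω => by
      rw [hY, Finset.abs_prod]
      exact Finset.prod_le_one (fun _ _ => abs_nonneg _) fun _ _ => h1 _
    have hgi : Integrable (fun ω => g (Y ω, τ n ω)) P := by
      refine Integrable.of_bound (C := 1) (hgm.comp (hYm.prodMk (hm n))).aestronglyMeasurable ?_
      refine Eventually.of_forall fun ω => ?_
      rw [hg, Real.norm_eq_abs, abs_mul, abs_mul, abs_of_pos (expNegTail_pos _)]
      exact mul_le_one₀ (hprod ω) (mul_nonneg (abs_nonneg _) (expNegTail_pos _).le)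
        (mul_le_one₀ (h1 _) (expNegTail_pos _).le (expNegTail_le_one h0 _))
    have key := hYτ.integral_fun_prodMk hYm (hm n) hgm.stronglyMeasurable hgi
    calc _ = ∫ ω, g (Y ω, τ n ω) ∂P := by
          refine integral_congr_ae (Eventually.of_forall fun ω => ?_)
          simp only [hg, hY]
          rw [Finset.prod_range_succ, ← Finset.sum_range_succ (fun j => τ j ω)]
          ring
      _ = _ := by
          rw [key]
          refine integral_congr_ae ?_
          filter_upwards [hpos] with ω hω
          simp only [hg]
          rw [integral_const_mul, hl n, integral_expMeasure_expNegTail hint hhm hc h0 h2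
            (Finset.sum_nonneg fun j _ => (hω j).le)]

/-- The generating functional of the arrival times of a Poisson process:
`∏_k (1 - h (Γ_k))` has expectation `exp (-∫_0^∞ h)`. -/
theorem tendsto_integral_prod_one_sub (hm : ∀ j, Measurable (τ j))
    (hl : ∀ j, P.map (τ j) = expMeasure 1) (hi : iIndepFun τ P) {h : ℝ → ℝ}
    (hint : Integrable h) (hhm : Measurable h) (hc : ContinuousOn h (Set.Ioi 0))
    (h0 : ∀ u, 0 ≤ h u) (h2 : ∀ u, h u ≤ 2) :
    Tendsto (fun n => ∫ ω, ∏ k ∈ Finset.range n, (1 - h (∑ j ∈ Finset.range (k + 1), τ j ω)) ∂P)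
      atTop (𝓝 (expNegTail h 0)) := by
  have := hi.isProbabilityMeasure
  have h1 : ∀ u, |1 - h u| ≤ 1 := fun u => by
    rw [abs_le]; constructor <;> linarith [h0 u, h2 u]
  have hG : Measurable (expNegTail h) := (continuous_expNegTail hint).measurable
  set A : ℕ → Ω → ℝ := fun n ω => ∑ j ∈ Finset.range n, τ j ω
  set Q : ℕ → Ω → ℝ := fun n ω => ∏ k ∈ Finset.range n, (1 - h (∑ j ∈ Finset.range (k + 1), τ j ω))
  have hAm : ∀ n, Measurable (A n) := fun n => by fun_prop
  have hQm : ∀ n, Measurable (Q n) := fun n => by fun_prop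
  have hQ1 : ∀ n ω, |Q n ω| ≤ 1 := fun n ω => by
    rw [Finset.abs_prod]
    exact Finset.prod_le_one (fun _ _ => abs_nonneg _) fun _ _ => h1 _
  have hG1 : ∀ u, |1 - expNegTail h u| ≤ 1 := fun u => by
    have := (expNegTail_pos (h := h) u).le
    have := expNegTail_le_one h0 u
    rw [abs_le]; constructor <;> linarith
  have hAtop : ∀ᵐ ω ∂P, Tendsto (fun n => A n ω) atTop atTop := by
    obtain ⟨c, hc0, hcω⟩ := exists_eventually_mul_le_sum_of_exp hm hl hi
    filter_upwards [hcω] with ω hω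
    exact tendsto_atTop_mono' _ hω (tendsto_natCast_atTop_atTop.const_mul_atTop hc0)
  -- Removing the factor `expNegTail h (A n)` costs nothing in the limit: `A n → ∞` and that factor
  -- tends to `1`.
  have hlim : Tendsto (fun n => ∫ ω, Q n ω * (1 - expNegTail h (A n ω)) ∂P) atTop (𝓝 (∫ _, 0 ∂P)) := by
    refine tendsto_integral_of_dominated_convergence (fun _ => 1) (fun n => ?_)
      (integrable_const _) (fun n => ?_) ?_
    · exact Measurable.aestronglyMeasurable (by fun_prop)
    · refine Eventually.of_forall fun ω => ?_
      rw [Real.norm_eq_abs, abs_mul]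
      exact mul_le_one₀ (hQ1 _ _) (abs_nonneg _) (hG1 _)
    · filter_upwards [hAtop] with ω hω
      have h3 : Tendsto (fun n => 1 - expNegTail h (A n ω)) atTop (𝓝 (1 - 1)) :=
        ((tendsto_expNegTail hint).comp hω).const_sub 1
      rw [sub_self] at h3
      refine squeeze_zero_norm (fun n => ?_) (by simpa using h3.norm)
      rw [norm_mul]
      exact mul_le_of_le_one_left (norm_nonneg _) (hQ1 _ _)
  have heq : ∀ n, ∫ ω, Q n ω ∂P =
      ∫ ω, Q n ω * (1 - expNegTail h (A n ω)) ∂P + expNegTail h 0 := by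
    intro n
    rw [← integral_prod_mul_expNegTail hm hl hi hint hhm hc h0 h2 n, ← integral_add]
    · refine integral_congr_ae (Eventually.of_forall fun ω => ?_)
      simp only [Q, A]
      ring
    · refine Integrable.of_bound (C := 1) (Measurable.aestronglyMeasurable (by fun_prop)) ?_
      refine Eventually.of_forall fun ω => ?_
      rw [Real.norm_eq_abs, abs_mul]
      exact mul_le_one₀ (hQ1 _ _) (abs_nonneg _) (hG1 _)
    · refine Integrable.of_bound (C := 1) (Measurable.aestronglyMeasurable (by fun_prop)) ?_
      refine Eventually.of_forall fun ω => ?_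
      rw [Real.norm_eq_abs, abs_mul, abs_of_pos (expNegTail_pos _)]
      exact mul_le_one₀ (hQ1 _ _) (expNegTail_pos _).le (expNegTail_le_one h0 _)
  have h3 := hlim.add_const (expNegTail h 0)
  simpa [← heq] using h3

end PoissonArrivals

/-! ### The exponent of the limiting stable law. -/

theorem Real.one_sub_cos_le_two_mul_rpow {r : ℝ} (hr0 : 0 ≤ r) (hr2 : r ≤ 2) (x : ℝ) :
    1 - Real.cos x ≤ 2 * |x| ^ r := by
  rcases le_total |x| 1 with h | h
  · have h1 := Real.one_sub_sq_div_two_le_cos (x := x)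
    rcases eq_or_ne x 0 with rfl | hx
    · simp
      positivity
    · have h2 : |x| ^ (2 : ℝ) ≤ |x| ^ r :=
        Real.rpow_le_rpow_of_exponent_ge (abs_pos.2 hx) h hr2
      rw [Real.rpow_two, sq_abs] at h2
      nlinarith [sq_nonneg x]
  · have h1 := Real.neg_one_le_cos x
    have h2 := Real.one_le_rpow h hr0
    linarith

/-- `u ↦ E[1 - cos (θ u^{-1/α} Y)]` for `u > 0`, where `Y` has law `κ`. -/
noncomputable def stableExponent (α : ℝ) (κ : Measure ℝ) (θ u : ℝ) : ℝ :=
  if 0 < u then ∫ y, (1 - Real.cos (θ * u ^ (-(1 / α)) * y)) ∂κ else 0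

section stableExponent

variable {α : ℝ} {κ : Measure ℝ}

theorem integrable_one_sub_cos [IsProbabilityMeasure κ] (b : ℝ) : Integrable (fun y => 1 - Real.cos (b * y)) κ := by
  refine Integrable.of_bound (C := 2) (Measurable.aestronglyMeasurable (by fun_prop)) ?_
  refine Eventually.of_forall fun y => ?_
  rw [Real.norm_eq_abs, abs_le]
  constructor <;> linarith [Real.cos_le_one (b * y), Real.neg_one_le_cos (b * y)]

theorem stableExponent_nonneg (θ u : ℝ) : 0 ≤ stableExponent α κ θ u := by
  rw [stableExponent]
  split_ifs
  · exact integral_nonneg fun y => sub_nonneg.2 (Real.cos_le_one _)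
  · exact le_rfl

theorem stableExponent_le_two [IsProbabilityMeasure κ] (θ u : ℝ) : stableExponent α κ θ u ≤ 2 := by
  rw [stableExponent]
  split_ifs
  · calc _ ≤ ∫ _, (2 : ℝ) ∂κ := by
          refine integral_mono (integrable_one_sub_cos _) (integrable_const _) fun y => ?_
          have := Real.neg_one_le_cos (θ * u ^ (-(1 / α)) * y)
          change 1 - Real.cos (θ * u ^ (-(1 / α)) * y) ≤ 2
          linarith
      _ = 2 := by simp
  · norm_num

theorem measurable_stableExponent [IsProbabilityMeasure κ] (θ : ℝ) : Measurable (stableExponent α κ θ) := by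
  refine Measurable.ite measurableSet_Ioi ?_ measurable_const
  have : Measurable fun q : ℝ × ℝ => 1 - Real.cos (θ * q.1 ^ (-(1 / α)) * q.2) := by fun_prop
  exact (StronglyMeasurable.integral_prod_right
    (f := fun u y => 1 - Real.cos (θ * u ^ (-(1 / α)) * y)) this.stronglyMeasurable).measurable

theorem continuousOn_stableExponent [IsProbabilityMeasure κ] (θ : ℝ) :
    ContinuousOn (stableExponent α κ θ) (Set.Ioi 0) := by
  have h : ContinuousOn (fun u : ℝ => ∫ y, (1 - Real.cos (θ * u ^ (-(1 / α)) * y)) ∂κ)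
      (Set.Ioi 0) := by
    refine continuousOn_of_dominated (bound := fun _ => 2) (fun u _ => ?_) (fun u _ => ?_)
      (integrable_const _) ?_
    · exact (integrable_one_sub_cos _).aestronglyMeasurable
    · refine Eventually.of_forall fun y => ?_
      rw [Real.norm_eq_abs, abs_le]
      constructor <;> linarith [Real.cos_le_one (θ * u ^ (-(1 / α)) * y),
        Real.neg_one_le_cos (θ * u ^ (-(1 / α)) * y)]
    · refine Eventually.of_forall fun y => ?_
      have h1 : ContinuousOn (fun u : ℝ => u ^ (-(1 / α))) (Set.Ioi 0) := fun u hu =>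
        (Real.continuousAt_rpow_const _ _ (Or.inl (ne_of_gt hu))).continuousWithinAt
      fun_prop
  refine h.congr fun u hu => ?_
  exact if_pos (Set.mem_Ioi.1 hu)

/-- Bounded by `2` near `0`; at infinity `1 - cos x ≤ 2|x|^r` gives decay `u^{-r/α}`, integrable
because `r > α`. -/
theorem integrable_stableExponent [IsProbabilityMeasure κ] (hα : 0 < α) {r : ℝ} (hαr : α < r)
    (hr2 : r ≤ 2)   (hκ : Integrable (fun y => |y| ^ r) κ) (θ : ℝ) : Integrable (stableExponent α κ θ) := by
  have hr0 : 0 < r := hα.trans hαr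
  have hm := measurable_stableExponent (α := α) (κ := κ) θ
  -- The default value `0` for `u ≤ 0` yields integrability on the whole line, as the lemmas on
  -- `expNegTail` require.
  have h1 : IntegrableOn (stableExponent α κ θ) (Set.Iic 0) :=
    (integrableOn_zero (μ := volume)).congr_fun (fun u hu => by
      rw [stableExponent, if_neg (not_lt.2 hu)]) measurableSet_Iic
  have h2 : IntegrableOn (stableExponent α κ θ) (Set.Ioc 0 1) := by
    refine Measure.integrableOn_of_bounded (M := 2) (by simp) hm.aestronglyMeasurable ?_
    refine Eventually.of_forall fun u => ?_
    rw [Real.norm_of_nonneg (stableExponent_nonneg _ _)]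
    exact stableExponent_le_two _ _
  have h3 : IntegrableOn (stableExponent α κ θ) (Set.Ioi 1) := by
    have h4 : IntegrableOn (fun u : ℝ => (2 * |θ| ^ r * ∫ y, |y| ^ r ∂κ) * u ^ (-(r / α)))
        (Set.Ioi 1) := by
      refine Integrable.const_mul (integrableOn_Ioi_rpow_of_lt ?_ one_pos) _
      rw [neg_lt_neg_iff, lt_div_iff₀ hα]
      linarith
    refine Integrable.mono' h4 hm.aestronglyMeasurable ?_
    filter_upwards [ae_restrict_mem measurableSet_Ioi] with u hu
    have hu0 : (0 : ℝ) < u := zero_lt_one.trans hu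
    rw [Real.norm_of_nonneg (stableExponent_nonneg _ _), stableExponent, if_pos hu0]
    calc _ ≤ ∫ y, 2 * |θ| ^ r * u ^ (-(r / α)) * |y| ^ r ∂κ := by
          refine integral_mono (integrable_one_sub_cos _) (hκ.const_mul _) fun y => ?_
          refine (Real.one_sub_cos_le_two_mul_rpow hr0.le hr2 _).trans_eq ?_
          rw [abs_mul, abs_mul, Real.mul_rpow (by positivity) (by positivity),
            Real.mul_rpow (by positivity) (by positivity), abs_of_pos (Real.rpow_pos_of_pos hu0 _),
            ← Real.rpow_mul hu0.le]
          have : -(1 / α) * r = -(r / α) := by ring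
          rw [this]
          ring
      _ = _ := by
          rw [integral_const_mul]
          ring
  rw [← integrableOn_univ, ← Set.Iic_union_Ioi (a := (0 : ℝ)),
    ← Set.Ioc_union_Ioi_eq_Ioi (zero_le_one' ℝ)]
  exact h1.union (h2.union h3)

/-- Substituting `u ↦ u |θ|^{-α}` absorbs `|θ|` into `u^{-1/α}`; the sign of `θ` disappears because
cosine is even. -/
theorem integral_stableExponent (hα : 0 < α) (θ : ℝ) :
    ∫ u in Set.Ioi 0, stableExponent α κ θ u =
      |θ| ^ α * ∫ u in Set.Ioi 0, stableExponent α κ 1 u := by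
  rcases eq_or_ne θ 0 with rfl | hθ
  · simp [stableExponent, Real.zero_rpow hα.ne']
  · have hb : 0 < |θ| ^ (-α) := Real.rpow_pos_of_pos (abs_pos.2 hθ) _
    have h1 : ∀ u ∈ Set.Ioi (0 : ℝ),
        stableExponent α κ θ u = stableExponent α κ 1 (u * |θ| ^ (-α)) := by
      intro u hu
      have hu' : 0 < u := hu
      rw [stableExponent, stableExponent, if_pos hu', if_pos (by positivity)]
      refine integral_congr_ae (Eventually.of_forall fun y => ?_)
      have h2 : (u * |θ| ^ (-α)) ^ (-(1 / α)) = u ^ (-(1 / α)) * |θ| := by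
        rw [Real.mul_rpow hu'.le hb.le, ← Real.rpow_mul (abs_nonneg _)]
        have : -α * -(1 / α) = 1 := by field_simp
        rw [this, Real.rpow_one]
      simp only [h2, one_mul]
      rw [← Real.cos_abs (θ * _ * _), ← Real.cos_abs (_ * |θ| * y)]
      simp only [abs_mul, abs_abs]
      ring_nf
    rw [setIntegral_congr_fun measurableSet_Ioi h1, integral_comp_mul_right_Ioi _ _ hb, zero_mul,
      Real.rpow_neg (abs_nonneg _), inv_inv, smul_eq_mul]

theorem expNegTail_stableExponent (hα : 0 < α) (θ : ℝ) :
    expNegTail (stableExponent α κ θ) 0 =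
      Real.exp (-(((∫ u in Set.Ioi 0, stableExponent α κ 1 u) ^ (1 / α)) ^ α * |θ| ^ α)) := by
  have hI : 0 ≤ ∫ u in Set.Ioi 0, stableExponent α κ 1 u :=
    integral_nonneg fun u => stableExponent_nonneg _ _
  rw [expNegTail, integral_stableExponent hα, ← Real.rpow_mul hI, one_div_mul_cancel hα.ne',
    Real.rpow_one, mul_comm]

end stableExponent

/-! ### Independence of arrivals, marks and signs. -/

theorem ProbabilityTheory.IndepFun.prodMk_left_of_prodMk_right {Ω β γ δ : Type*}
    [MeasurableSpace Ω] [MeasurableSpace β] [MeasurableSpace γ] [MeasurableSpace δ] {P : Measure Ω}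
    [IsProbabilityMeasure P] {X : Ω → β} {Y : Ω → γ} {Z : Ω → δ} (hX : Measurable X)
    (hY : Measurable Y) (hZ : Measurable Z) (h : IndepFun X (fun ω => (Y ω, Z ω)) P)
    (hYZ : IndepFun Y Z P) : IndepFun (fun ω => (X ω, Y ω)) Z P := by
  have hXY : IndepFun X Y P := h.comp measurable_id measurable_fst
  rw [indepFun_iff_map_prod_eq_prod_map_map (by fun_prop) (by fun_prop)] at h hYZ hXY ⊢
  have e : (fun ω => ((X ω, Y ω), Z ω)) =
      MeasurableEquiv.prodAssoc.symm ∘ fun ω => (X ω, (Y ω, Z ω)) := rfl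
  have := Measure.isProbabilityMeasure_map (μ := P) hX.aemeasurable
  have := Measure.isProbabilityMeasure_map (μ := P) hY.aemeasurable
  have := Measure.isProbabilityMeasure_map (μ := P) hZ.aemeasurable
  rw [e, ← Measure.map_map (by fun_prop) (by fun_prop), h, hYZ, hXY,
    ← Measure.prodAssoc_prod, MeasurableEquiv.map_symm_map]

/-- The σ-algebras of all `X k` and `Y k`, indexed by `ℕ ⊕ ℕ`, are shown to be jointly independent;
the two disjoint halves of the index set then generate independent σ-algebras. -/
theorem ProbabilityTheory.iIndepFun.indepFun_pi_of_pairs {Ω β γ : Type*} [MeasurableSpace Ω]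
    [MeasurableSpace β] [MeasurableSpace γ] {P : Measure Ω} {X : ℕ → Ω → β} {Y : ℕ → Ω → γ}
    (hX : ∀ k, Measurable (X k)) (hY : ∀ k, Measurable (Y k))
    (h : iIndepFun (fun k ω => (X k ω, Y k ω)) P) (hXY : ∀ k, IndepFun (X k) (Y k) P) :
    IndepFun (fun ω k => X k ω) (fun ω k => Y k ω) P := by
  have hP := h.isProbabilityMeasure
  let m : ℕ ⊕ ℕ → MeasurableSpace Ω := Sum.elim
    (fun k => MeasurableSpace.comap (X k) inferInstance)
    (fun k => MeasurableSpace.comap (Y k) inferInstance)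
  have hle : ∀ i, m i ≤ ‹MeasurableSpace Ω› := by
    rintro (k | k)
    · exact (hX k).comap_le
    · exact (hY k).comap_le
  have hind : iIndep m P := by
    rw [iIndep_iff]
    intro S f hf
    classical
    set K := S.toLeft ∪ S.toRight
    -- Absent indices are padded with `Set.univ`, so that each `k` contributes one event `A k ∩ B k`
    -- of the pair.
    set A : ℕ → Set Ω := fun k => if Sum.inl k ∈ S then f (Sum.inl k) else Set.univ with hA
    set B : ℕ → Set Ω := fun k => if Sum.inr k ∈ S then f (Sum.inr k) else Set.univ with hB
    have hAm : ∀ k, MeasurableSet[MeasurableSpace.comap (X k) inferInstance] (A k) := by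
      intro k
      simp only [hA]
      split_ifs with hk
      · exact hf _ hk
      · exact MeasurableSet.univ
    have hBm : ∀ k, MeasurableSet[MeasurableSpace.comap (Y k) inferInstance] (B k) := by
      intro k
      simp only [hB]
      split_ifs with hk
      · exact hf _ hk
      · exact MeasurableSet.univ
    have h1 : ⋂ i ∈ S, f i = ⋂ k ∈ K, A k ∩ B k := by
      ext ω
      simp only [Set.mem_iInter, Set.mem_inter_iff, hA, hB, K, Finset.mem_union,
        Finset.mem_toLeft, Finset.mem_toRight]
      constructor
      · intro h k _
        constructor <;> split_ifs with hk
        · exact h _ hk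
        · trivial
        · exact h _ hk
        · trivial
      · rintro h (k | k) hk
        · simpa [hk] using (h k (Or.inl hk)).1
        · simpa [hk] using (h k (Or.inr hk)).2
    have h2 : P (⋂ k ∈ K, A k ∩ B k) = ∏ k ∈ K, P (A k ∩ B k) := by
      refine (iIndep_iff _ _).1 h.iIndep K fun k _ => ?_
      obtain ⟨a, ha, ha'⟩ := hAm k
      obtain ⟨b, hb, hb'⟩ := hBm k
      exact ⟨a ×ˢ b, ha.prod hb, by rw [← ha', ← hb']; rfl⟩
    have h3 : ∀ k, P (A k ∩ B k) = P (A k) * P (B k) := fun k =>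
      (Indep_iff _ _ _).1 ((IndepFun_iff_Indep _ _ _).1 (hXY k)) _ _ (hAm k) (hBm k)
    rw [h1, h2, Finset.prod_congr rfl fun k _ => h3 k, Finset.prod_mul_distrib,
      ← Finset.toLeft_disjSum_toRight (u := S), Finset.prod_disjSum]
    congr 1
    · rw [← Finset.prod_subset (s₁ := S.toLeft) Finset.subset_union_left]
      · refine Finset.prod_congr (by simp) fun k hk => ?_
        rw [Finset.mem_toLeft] at hk
        simp [hA, hk]
      · intro k _ hk
        rw [Finset.mem_toLeft] at hk
        simp [hA, hk]
    · rw [← Finset.prod_subset (s₁ := S.toRight) Finset.subset_union_right]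
      · refine Finset.prod_congr (by simp) fun k hk => ?_
        rw [Finset.mem_toRight] at hk
        simp [hB, hk]
      · intro k _ hk
        rw [Finset.mem_toRight] at hk
        simp [hB, hk]
  have h4 := indep_iSup_of_disjoint hle hind (S := Set.range Sum.inl) (T := Set.range Sum.inr)
    (by rw [Set.disjoint_left]; rintro _ ⟨k, rfl⟩ ⟨j, hj⟩; cases hj)
  rw [IndepFun_iff_Indep]
  refine indep_of_indep_of_le_left (indep_of_indep_of_le_right h4 ?_) ?_
  · rw [MeasurableSpace.pi, MeasurableSpace.comap_iSup]
    refine iSup_le fun k => ?_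
    rw [MeasurableSpace.comap_comp]
    exact le_iSup₂_of_le (Sum.inr k) ⟨k, rfl⟩ le_rfl
  · rw [MeasurableSpace.pi, MeasurableSpace.comap_iSup]
    refine iSup_le fun k => ?_
    rw [MeasurableSpace.comap_comp]
    exact le_iSup₂_of_le (Sum.inl k) ⟨k, rfl⟩ le_rfl

/-- Integrating the constant conditional probability over `X ∈ A` gives `P(X ∈ A, ρ = 1) = P(X ∈ A)
/ 2`. As `ρ` has two values, `ρ ∈ B` is one of four events, each covered by this identity or its
complement. -/
theorem indepFun_of_condExp_eq_half {Ω β : Type*} [MeasurableSpace Ω]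
    [MeasurableSpace β] {P : Measure Ω} [IsProbabilityMeasure P] {X : Ω → β} {ρ : Ω → ℝ}
    (hX : Measurable X) (hρ : Measurable ρ) (hs : ∀ ω, ρ ω = 1 ∨ ρ ω = -1)
    (hfair : P⟦ρ ⁻¹' {1} | MeasurableSpace.comap X inferInstance⟧ =ᵐ[P] fun _ => (1 / 2 : ℝ)) :
    IndepFun X ρ P ∧ ∫ ω, ρ ω ∂P = 0 := by
  have hS : MeasurableSet (ρ ⁻¹' {1}) := hρ (measurableSet_singleton 1)
  have h1 : ∀ A, MeasurableSet A → P.real (X ⁻¹' A ∩ ρ ⁻¹' {1}) = P.real (X ⁻¹' A) / 2 := by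
    intro A hA
    have h2 : ∫ ω in X ⁻¹' A, (P⟦ρ ⁻¹' {1} | MeasurableSpace.comap X inferInstance⟧) ω ∂P =
        ∫ ω in X ⁻¹' A, (ρ ⁻¹' {1}).indicator (fun _ => (1 : ℝ)) ω ∂P :=
      setIntegral_condExp hX.comap_le ((integrable_const (1 : ℝ)).indicator hS) ⟨A, hA, rfl⟩
    rw [setIntegral_congr_ae (g := fun _ => (1 / 2 : ℝ)) (hX hA)
      (by filter_upwards [hfair] with ω hω _ using hω), setIntegral_const,
      setIntegral_indicator hS, setIntegral_const] at h2
    simp only [smul_eq_mul, mul_one] at h2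
    linarith
  have h1u : P.real (ρ ⁻¹' {1}) = 1 / 2 := by simpa using h1 Set.univ MeasurableSet.univ
  constructor
  · rw [indepFun_iff_measure_inter_preimage_eq_mul]
    intro A B hA hB
    have hAm : MeasurableSet (X ⁻¹' A) := hX hA
    have h3 : P.real (X ⁻¹' A ∩ (ρ ⁻¹' {1})ᶜ) = P.real (X ⁻¹' A) / 2 := by
      have := measureReal_inter_add_sdiff (μ := P) (s := X ⁻¹' A) hS
      rw [← Set.sdiff_eq]
      linarith [h1 A hA]
    have h3u : P.real (ρ ⁻¹' {1})ᶜ = 1 / 2 := by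
      rw [measureReal_compl hS]; simp [h1u]; norm_num
    have key : P.real (X ⁻¹' A ∩ ρ ⁻¹' B) = P.real (X ⁻¹' A) * P.real (ρ ⁻¹' B) := by
      by_cases hb1 : (1 : ℝ) ∈ B <;> by_cases hb2 : (-1 : ℝ) ∈ B
      · have : ρ ⁻¹' B = Set.univ := by
          ext ω; rcases hs ω with h | h <;> simp [h, hb1, hb2]
        simp [this]
      · have : ρ ⁻¹' B = ρ ⁻¹' {1} := by
          ext ω; rcases hs ω with h | h <;> simp [h, hb1, hb2]; norm_num
        rw [this, h1 A hA, h1u]; ring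
      · have : ρ ⁻¹' B = (ρ ⁻¹' {1})ᶜ := by
          ext ω; rcases hs ω with h | h <;> simp [h, hb1, hb2]; norm_num
        rw [this, h3, h3u]; ring
      · have : ρ ⁻¹' B = ∅ := by
          ext ω; rcases hs ω with h | h <;> simp [h, hb1, hb2]
        simp [this]
    rw [← ENNReal.toReal_eq_toReal_iff' (by finiteness) (by finiteness), ENNReal.toReal_mul]
    exact key
  · have h4 : ρ = fun ω => 2 * (ρ ⁻¹' {1}).indicator (fun _ => (1 : ℝ)) ω - 1 := by
      ext ω
      rcases hs ω with h | h
      · rw [Set.indicator_of_mem (by simp [h]), h]; norm_num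
      · rw [Set.indicator_of_notMem (by simp [h]; norm_num), h]; norm_num
    have hi : Integrable ((ρ ⁻¹' {1}).indicator fun _ => (1 : ℝ)) P :=
      (integrable_const (1 : ℝ)).indicator hS
    rw [h4, integral_sub (hi.const_mul 2) (integrable_const _), integral_const_mul,
      integral_indicator hS, setIntegral_const, h1u]
    simp

/-! ### Sections of `f` as a measurable map into `L^p`. -/

theorem measurable_of_preimage_ball {Y F : Type*} [MeasurableSpace Y] [PseudoMetricSpace F]
    [SecondCountableTopology F] [MeasurableSpace F] [BorelSpace F] {Φ : Y → F}
    (h : ∀ c r, MeasurableSet (Φ ⁻¹' Metric.ball c r)) : Measurable Φ := by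
  refine measurable_of_isOpen fun U hU => ?_
  choose! r hr0 hr using fun x hx => Metric.isOpen_iff.1 hU x hx
  obtain ⟨S, hS, hSU⟩ := TopologicalSpace.isOpen_iUnion_countable
    (fun x : U => Metric.ball (x : F) (r x)) fun x => Metric.isOpen_ball
  have hU' : U = ⋃ x ∈ S, Metric.ball (x : F) (r x) := by
    rw [hSU]
    refine Set.Subset.antisymm (fun x hx => ?_) (Set.iUnion_subset fun x => hr x x.2)
    exact Set.mem_iUnion.2 ⟨⟨x, hx⟩, Metric.mem_ball_self (hr0 x hx)⟩
  rw [hU', Set.preimage_iUnion₂]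
  exact MeasurableSet.biUnion hS fun x _ => h _ _

open Classical in
/-- The section `f (·, y)` as an element of `L^p`, or `0` if it is not `p`-integrable. -/
noncomputable def lpSection {X Y : Type*} [MeasurableSpace X] (f : X × Y → ℂ) (p : ℝ≥0∞)
    (μ : Measure X) (y : Y) : Lp ℂ p μ :=
  if h : MemLp (fun x => f (x, y)) p μ then h.toLp else 0

section lpSection

variable {X Y : Type*} [MeasurableSpace X] {μ : Measure X} {p : ℝ≥0∞} {f : X × Y → ℂ}

theorem coeFn_lpSection {y : Y} (h : MemLp (fun x => f (x, y)) p μ) :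
    lpSection f p μ y =ᵐ[μ] fun x => f (x, y) := by
  rw [lpSection, dif_pos h]
  exact h.coeFn_toLp

theorem enorm_lpSection_le (y : Y) : ‖lpSection f p μ y‖ₑ ≤ eLpNorm (fun x => f (x, y)) p μ := by
  rw [lpSection]
  split_ifs with h
  · rw [Lp.enorm_toLp]
  · rw [Lp.enorm_def, eLpNorm_congr_ae (Lp.coeFn_zero ℂ p μ), eLpNorm_zero]
    exact zero_le

variable [MeasurableSpace Y] [SFinite μ]

theorem measurable_eLpNorm_section (hp0 : p ≠ 0) (hp : p ≠ ∞) {g : X → ℂ} (hg : Measurable g)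
    (hf : Measurable f) : Measurable fun y => eLpNorm (fun x => f (x, y) - g x) p μ := by
  simp_rw [eLpNorm_eq_lintegral_rpow_enorm_toReal hp0 hp]
  refine Measurable.pow_const ?_ _
  refine Measurable.lintegral_prod_left' (f := fun q : X × Y => ‖f q - g q.1‖ₑ ^ p.toReal) ?_
  fun_prop

theorem measurableSet_memLp_section (hp0 : p ≠ 0) (hp : p ≠ ∞) (hf : Measurable f) :
    MeasurableSet {y | MemLp (fun x => f (x, y)) p μ} := by
  have h : {y | MemLp (fun x => f (x, y)) p μ} =
      {y | eLpNorm (fun x => f (x, y) - (fun _ => 0 : X → ℂ) x) p μ < ∞} := by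
    ext y
    simp only [sub_zero]
    exact ⟨fun h => h.2, fun h =>
      ⟨(hf.comp measurable_prodMk_right).aestronglyMeasurable, h⟩⟩
  rw [h]
  exact measurableSet_lt (measurable_eLpNorm_section hp0 hp measurable_const hf) measurable_const

/-- `L^p` is separable here, so preimages of balls suffice. Where the section lies in `L^p`, being
in a ball is a bound on the norm of `f(·, y) - c`, measurable in `y` by Tonelli; elsewhere the map
is constant. -/
theorem measurable_lpSection [MeasurableSpace.CountablyGenerated X] [Fact (1 ≤ p)] (hp : p ≠ ∞)
    (hf : Measurable f) : Measurable (lpSection f p μ) := by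
  have : Fact (p ≠ ∞) := ⟨hp⟩
  have hp0 : p ≠ 0 := (zero_lt_one.trans_le (Fact.out : 1 ≤ p)).ne'
  refine measurable_of_preimage_ball fun c r => ?_
  set S := {y | MemLp (fun x => f (x, y)) p μ} with hS
  have hSm : MeasurableSet S := measurableSet_memLp_section hp0 hp hf
  have hcm : Measurable c := (Lp.stronglyMeasurable c).measurable
  have h1 : lpSection f p μ ⁻¹' Metric.ball c r =
      S ∩ {y | eLpNorm (fun x => f (x, y) - c x) p μ < ENNReal.ofReal r} ∪
        Sᶜ ∩ {_y | (0 : Lp ℂ p μ) ∈ Metric.ball c r} := by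
    ext y
    by_cases hy : y ∈ S
    · simp only [Set.mem_preimage, Set.mem_union, Set.mem_inter_iff, hy, true_and,
        Set.mem_compl_iff, not_true_eq_false, false_and, or_false, Set.mem_ofPred_eq]
      rw [← Metric.eball_ofReal, Metric.mem_eball, Lp.edist_def]
      rw [eLpNorm_congr_ae (g := fun x => f (x, y) - c x)]
      filter_upwards [coeFn_lpSection hy] with x hx
      simp [hx]
    · have h0 : lpSection f p μ y = 0 := dif_neg hy
      simp [hy, h0]
  rw [h1]
  exact (hSm.inter (measurableSet_lt (measurable_eLpNorm_section hp0 hp hcm hf)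
    measurable_const)).union (hSm.compl.inter (MeasurableSet.const _))

end lpSection

/-- No measurability of `S` enters: the pulled-back measure of a set is at most the measure of its
image, which lies in a spanning set of finite volume. -/
instance lebesgueOn.instSigmaFinite {n : ℕ} (S : Set (EuclideanSpace ℝ (Fin n))) :
    SigmaFinite (lebesgueOn S) := by
  refine ⟨⟨⟨fun k => Subtype.val ⁻¹' spanningSets volume k, fun _ => trivial, fun k => ?_, ?_⟩⟩⟩
  · refine (Measure.comap_apply_le _ _ ?_).trans_lt
      ((measure_mono (Set.image_preimage_subset _ _)).trans_lt (measure_spanningSets_lt_top _ k))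
    exact (measurable_subtype_coe (measurableSet_spanningSets volume k)).nullMeasurableSet
  · rw [← Set.preimage_iUnion, iUnion_spanningSets, Set.preimage_univ]

/-- A law all of whose one-dimensional images are symmetric `α`-stable is symmetric
`α`-stable. -/
theorem isSymmetricAlphaStable_of_forall_map {F : Type*} [NormedAddCommGroup F] [NormedSpace ℝ F]
    [CompleteSpace F] [SecondCountableTopology F] [MeasurableSpace F] [BorelSpace F] {α : ℝ}
    (hα : 0 < α) (ν : Measure F) [IsProbabilityMeasure ν]
    (h : ∀ l : F →L[ℝ] ℝ, ∃ σ : ℝ, 0 ≤ σ ∧ IsSymmetricStableReal α σ (ν.map l)) :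
    IsSymmetricAlphaStable α ν := by
  refine ⟨fun a b ha hb => ?_, h⟩
  have hs : 0 < a ^ α + b ^ α := by positivity
  have hc0 : 0 < (a ^ α + b ^ α) ^ (1 / α) := by positivity
  have hcα : ((a ^ α + b ^ α) ^ (1 / α)) ^ α = a ^ α + b ^ α := by
    rw [← Real.rpow_mul hs.le, one_div_mul_cancel hα.ne', Real.rpow_one]
  refine ⟨_, hc0, hcα, 0, ?_⟩
  set c := (a ^ α + b ^ α) ^ (1 / α)
  have hm1 : Measurable fun z : F × F => a • z.1 + b • z.2 := by fun_prop
  have hm2 : Measurable fun u : F => c • u + 0 := by fun_prop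
  have := Measure.isProbabilityMeasure_map (μ := ν.prod ν) hm1.aemeasurable
  have := Measure.isProbabilityMeasure_map (μ := ν) hm2.aemeasurable
  -- Compared at `l`, the two characteristic functionals are `exp(-σ^α a^α) exp(-σ^α b^α)` and
  -- `exp(-σ^α c^α)`.
  refine Measure.ext_of_charFunDual (funext fun l => ?_)
  obtain ⟨σ, _, hl⟩ := h l
  have hl' : ∀ t : ℝ, 0 < t → ∫ u, Complex.exp (l (t • u) * Complex.I) ∂ν =
      Complex.exp ((-(σ ^ α * t ^ α) : ℝ) : ℂ) := by
    intro t ht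
    have h1 := hl t
    rw [charFun_apply_real, integral_map l.continuous.measurable.aemeasurable
      (Measurable.aestronglyMeasurable (by fun_prop)), abs_of_pos ht] at h1
    rw [← h1]
    simp
  rw [charFunDual_apply, charFunDual_apply, integral_map hm1.aemeasurable
      (Measurable.aestronglyMeasurable (by fun_prop)), integral_map hm2.aemeasurable
      (Measurable.aestronglyMeasurable (by fun_prop))]
  have h2 : ∀ z : F × F, Complex.exp (l (a • z.1 + b • z.2) * Complex.I) =
      Complex.exp (l (a • z.1) * Complex.I) * Complex.exp (l (b • z.2) * Complex.I) := by
    intro z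
    rw [← Complex.exp_add, map_add]
    push_cast
    ring_nf
  simp_rw [h2, add_zero]
  rw [integral_prod_mul (fun u : F => Complex.exp (l (a • u) * Complex.I))
    (fun u : F => Complex.exp (l (b • u) * Complex.I)), hl' a ha, hl' b hb, hl' c hc0, hcα,
    ← Complex.exp_add]
  push_cast
  ring_nf

/-! ### Almost sure convergence of the LePage series. -/

theorem exists_forall_rpow_neg_le {γ : ℕ → ℝ} (h0 : ∀ k, 0 < γ k) {c : ℝ} (hc : 0 < c)
    (h : ∀ᶠ k : ℕ in atTop, c * ((k : ℝ) + 1) ≤ γ k) {q : ℝ} (hq : 0 < q) :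
    ∃ M : ℝ, ∀ k, γ k ^ (-q) ≤ M * ((k : ℝ) + 1) ^ (-q) := by
  have h1 : IsBoundedUnder (· ≤ ·) atTop fun k : ℕ => ((k : ℝ) + 1) / γ k := by
    refine ⟨1 / c, eventually_map.2 ?_⟩
    filter_upwards [h] with k hk
    rw [div_le_div_iff₀ (h0 k) hc]
    linarith
  obtain ⟨M, hM⟩ := h1.bddAbove_range
  refine ⟨M ^ q, fun k => ?_⟩
  have hk : 0 < (k : ℝ) + 1 := by positivity
  have h2 : ((k : ℝ) + 1) / γ k ≤ M := hM ⟨k, rfl⟩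
  have h3 : (((k : ℝ) + 1) / γ k) ^ q ≤ M ^ q :=
    Real.rpow_le_rpow (div_nonneg hk.le (h0 k).le) h2 hq.le
  rw [Real.div_rpow hk.le (h0 k).le] at h3
  rw [Real.rpow_neg (h0 k).le, Real.rpow_neg hk.le, ← div_eq_mul_inv, le_div_iff₀ (by positivity),
    mul_comm, ← div_eq_mul_inv]
  exact h3

/-- Pathwise, the arrivals are replaced by a random constant times `k + 1`, which leaves a
deterministic summable sequence against `Z k`. No independence between `Γ` and `Z` is therefore
needed. The cases used are `Z = 1` and `Z k = ‖Φ (V k)‖^p`. -/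
theorem ae_tsum_rpow_arrivals_mul_lt_top {Ω : Type*} [MeasurableSpace Ω] {P : Measure Ω}
    {Γ : ℕ → Ω → ℝ} (hΓ : IsPoissonArrivalTimes P Γ) {α r : ℝ} (hα : 0 < α) (hαr : α < r)
    {Z : ℕ → Ω → ℝ≥0∞} (hZ : ∀ k, Measurable (Z k)) {C : ℝ≥0∞} (hC : C ≠ ∞)
    (hZC : ∀ k, ∫⁻ ω, Z k ω ∂P ≤ C) :
    ∀ᵐ ω ∂P, ∑' k, ‖Γ k ω ^ (-(1 / α))‖ₑ ^ r * Z k ω ≠ ∞ := by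
  obtain ⟨τ, hm, hl, hi, hΓτ⟩ := hΓ
  have hr0 : 0 < r := hα.trans hαr
  have hpos := ae_pos_of_map_eq_expMeasure hm hl
  obtain ⟨c, hc0, hc⟩ := exists_eventually_mul_le_sum_of_exp hm hl hi
  set a : ℕ → ℝ≥0∞ := fun k => ENNReal.ofReal (((k : ℝ) + 1) ^ (-(1 / α)) ) ^ r with ha
  have hasum : ∑' k, a k ≠ ∞ := by
    have h1 : ∀ k : ℕ, a k = ENNReal.ofReal (1 / ((k + 1 : ℕ) : ℝ) ^ (r / α)) := by
      intro k
      rw [ha]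
      simp only
      have h2 : 1 / ((k + 1 : ℕ) : ℝ) ^ (r / α) = ((k : ℝ) + 1) ^ (-(r / α)) := by
        push_cast
        rw [Real.rpow_neg (by positivity), one_div]
      rw [ENNReal.ofReal_rpow_of_nonneg (by positivity) hr0.le, ← Real.rpow_mul (by positivity), h2]
      congr 2
      ring
    simp_rw [h1]
    refine Summable.tsum_ofReal_ne_top ?_
    exact (summable_nat_add_iff 1).2
      (Real.summable_one_div_nat_rpow.2 ((one_lt_div hα).2 hαr))
  have hfin : ∫⁻ ω, ∑' k, a k * Z k ω ∂P ≠ ∞ := by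
    rw [lintegral_tsum fun k => ((hZ k).const_mul _).aemeasurable]
    refine ne_top_of_le_ne_top (ENNReal.mul_ne_top hasum hC) ?_
    rw [← ENNReal.tsum_mul_right]
    refine ENNReal.tsum_le_tsum fun k => ?_
    rw [lintegral_const_mul _ (hZ k)]
    gcongr
    exact hZC k
  filter_upwards [hpos, hc, ae_lt_top (Measurable.tsum fun k => (hZ k).const_mul _) hfin]
    with ω hω hcω hlt
  have hΓ0 : ∀ k, 0 < Γ k ω := fun k => by
    rw [hΓτ]
    exact Finset.sum_pos (fun j _ => hω j) ⟨0, by simp⟩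
  obtain ⟨M, hM⟩ := exists_forall_rpow_neg_le hΓ0 hc0 (by
    filter_upwards [(tendsto_add_atTop_nat 1).eventually hcω] with k hk
    rw [hΓτ]
    exact_mod_cast hk) (q := 1 / α) (by positivity)
  refine ne_top_of_le_ne_top (b := ENNReal.ofReal M ^ r * ∑' k, a k * Z k ω)
    (ENNReal.mul_ne_top (ENNReal.rpow_ne_top_of_nonneg hr0.le (by simp)) hlt.ne) ?_
  rw [← ENNReal.tsum_mul_left]
  refine ENNReal.tsum_le_tsum fun k => ?_
  rw [← mul_assoc]
  gcongr
  rw [ha, ← ENNReal.mul_rpow_of_nonneg _ _ hr0.le, ← ENNReal.ofReal_mul' (by positivity),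
    Real.enorm_eq_ofReal (Real.rpow_nonneg (hΓ0 k).le _)]
  exact ENNReal.rpow_le_rpow (ENNReal.ofReal_le_ofReal (hM k)) hr0.le

/-- The joint independence properties of the input of the LePage series. -/
structure IsSignedMarkedArrivals {Ω Y : Type*} [MeasurableSpace Ω] [MeasurableSpace Y]
    (P : Measure Ω) (Γ : ℕ → Ω → ℝ) (V : ℕ → Ω → Y) (ρ : ℕ → Ω → ℝ) (κ : Measure Y) : Prop where
  arrivals : IsPoissonArrivalTimes P Γ
  measurable_V : ∀ k, Measurable (V k)
  map_V : ∀ k, P.map (V k) = κ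
  rademacher : IsRademacherSeq P ρ
  indep_V_ρ : ∀ k, IndepFun (V k) (ρ k) P
  iIndep_pairs : iIndepFun (fun k ω => (V k ω, ρ k ω)) P
  indep_arrivals : IndepFun (fun ω k => Γ k ω) (fun ω k => (V k ω, ρ k ω)) P

theorem map_eq_smul_lebesgueOn_of_isUniform {Ω : Type*} [MeasurableSpace Ω] {P : Measure Ω} {m : ℕ}
    {E : Set (EuclideanSpace ℝ (Fin m))} (hE : MeasurableSet E) {V : Ω → E} (hV : Measurable V)
    (hu : pdf.IsUniform (fun ω => (V ω : EuclideanSpace ℝ (Fin m))) E P volume) :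
    P.map V = (volume E)⁻¹ • lebesgueOn E := by
  have h1 : P.map V = ((P.map V).map Subtype.val).comap Subtype.val :=
    ((MeasurableEmbedding.subtype_coe hE).comap_map _).symm
  rw [h1, Measure.map_map measurable_subtype_coe hV]
  have h2 : P.map (Subtype.val ∘ V) = ProbabilityTheory.cond volume E := hu
  rw [h2, ProbabilityTheory.cond, Measure.comap_smul]
  congr 1
  rw [(MeasurableEmbedding.subtype_coe hE).comap_restrict, Subtype.coe_preimage_self,
    Measure.restrict_univ]

theorem IsLePageInput.isSignedMarkedArrivals {Ω : Type*} [MeasurableSpace Ω] {P : Measure Ω}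
    [IsProbabilityMeasure P] {m : ℕ} {E : Set (EuclideanSpace ℝ (Fin m))} (hE : MeasurableSet E)
    {Γ : ℕ → Ω → ℝ} {V : ℕ → Ω → E} {ρ : ℕ → Ω → ℝ} (h : IsLePageInput P E Γ V ρ) :
    IsSignedMarkedArrivals P Γ V ρ ((volume E)⁻¹ • lebesgueOn E) where
  arrivals := h.arrivals
  measurable_V := h.measurable_V
  map_V k := map_eq_smul_lebesgueOn_of_isUniform hE (h.measurable_V k) (h.uniform k)
  rademacher := ⟨h.measurable_ρ, h.sign, fun k => (indepFun_of_condExp_eq_half (h.measurable_V k)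
    (h.measurable_ρ k) (h.sign k) (h.fair k)).2,
    h.iIndep_pairs.comp (fun _ => Prod.snd) fun _ => measurable_snd⟩
  indep_V_ρ k := (indepFun_of_condExp_eq_half (h.measurable_V k)
    (h.measurable_ρ k) (h.sign k) (h.fair k)).1
  iIndep_pairs := h.iIndep_pairs
  indep_arrivals := h.indep_arrivals

theorem IsPoissonArrivalTimes.measurable {Ω : Type*} [MeasurableSpace Ω] {P : Measure Ω}
    {Γ : ℕ → Ω → ℝ} (hΓ : IsPoissonArrivalTimes P Γ) (k : ℕ) : Measurable (Γ k) := by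
  obtain ⟨τ, hm, -, -, hΓτ⟩ := hΓ
  have : Γ k = fun ω => ∑ j ∈ Finset.range (k + 1), τ j ω := funext (hΓτ k)
  rw [this]
  fun_prop

namespace IsSignedMarkedArrivals

variable {Ω Y : Type*} [MeasurableSpace Ω] [MeasurableSpace Y] {P : Measure Ω} {Γ : ℕ → Ω → ℝ}
  {V : ℕ → Ω → Y} {ρ : ℕ → Ω → ℝ} {κ : Measure Y}

theorem indepFun_arrivals_marks_signs (h : IsSignedMarkedArrivals P Γ V ρ κ) :
    IndepFun (fun ω => ((fun k => Γ k ω : ℕ → ℝ), (fun k => V k ω : ℕ → Y)))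
      (fun ω k => ρ k ω) P := by
  have := h.iIndep_pairs.isProbabilityMeasure
  have hΓ : ∀ k, Measurable (Γ k) := h.arrivals.measurable
  have hV : ∀ k, Measurable (V k) := h.measurable_V
  have hρ : ∀ k, Measurable (ρ k) := h.rademacher.measurable
  refine IndepFun.prodMk_left_of_prodMk_right (by fun_prop) (by fun_prop) (by fun_prop) ?_
    (h.iIndep_pairs.indepFun_pi_of_pairs hV hρ h.indep_V_ρ)
  exact h.indep_arrivals.comp (ψ := fun q : ℕ → Y × ℝ => (fun k => (q k).1, fun k => (q k).2))
    measurable_id (by fun_prop)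

/-- Almost sure convergence of the LePage series in `L^p`. -/
theorem ae_exists_tendsto (h : IsSignedMarkedArrivals P Γ V ρ κ) {X : Type*} [MeasurableSpace X]
    [MeasurableSpace.CountablyGenerated X] {μ : Measure X} [SFinite μ] {p : ℝ≥0∞}
    [hp1 : Fact (1 ≤ p)] (hp : p ≠ ∞) {α : ℝ} (hα0 : 0 < α) (hα2 : α < 2) (hαp : α < p.toReal)
    {Φ : Y → Lp ℂ p μ} (hΦ : Measurable Φ) (hΦp : ∫⁻ y, ‖Φ y‖ₑ ^ p.toReal ∂κ ≠ ∞) :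
    ∀ᵐ ω ∂P, ∃ u, Tendsto
      (fun N => ∑ k ∈ Finset.range N, ρ k ω • Γ k ω ^ (-(1 / α)) • Φ (V k ω)) atTop (𝓝 u) := by
  have := h.iIndep_pairs.isProbabilityMeasure
  have hp' : Fact (p ≠ ∞) := ⟨hp⟩
  have hΓ : ∀ k, Measurable (Γ k) := h.arrivals.measurable
  have hV : ∀ k, Measurable (V k) := h.measurable_V
  have hρ : ∀ k, Measurable (ρ k) := h.rademacher.measurable
  have hαr : α < min p.toReal 2 := lt_min hαp hα2
  let W : (ℕ → ℝ) × (ℕ → Y) → ℕ → Lp ℂ p μ := fun q k => q.1 k ^ (-(1 / α)) • Φ (q.2 k)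
  have hW : Measurable W := by fun_prop
  have hs : MeasurableSet {q : (ℕ → Lp ℂ p μ) × (ℕ → ℝ) |
      ∃ u, Tendsto (fun N => ∑ k ∈ Finset.range N, q.2 k • q.1 k) atTop (𝓝 u)} :=
    measurableSet_exists_tendsto fun N => by fun_prop
  -- By independence, arrivals and marks may be frozen at `ω` while the signs are drawn at a
  -- separate `ω'`.
  refine (h.indepFun_arrivals_marks_signs.comp hW measurable_id).ae_of_ae_ae
    (hW.comp (by fun_prop)) (measurable_id.comp (by fun_prop)) hs ?_
  have h1 := ae_tsum_rpow_arrivals_mul_lt_top h.arrivals hα0 hαr (Z := fun _ _ => 1)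
    (fun _ => measurable_const) (C := 1) (by simp) (by simp)
  have h2 := ae_tsum_rpow_arrivals_mul_lt_top h.arrivals hα0 hαr
    (Z := fun k ω => ‖Φ (V k ω)‖ₑ ^ p.toReal) (fun k => by fun_prop) hΦp fun k => by
      rw [← h.map_V k, lintegral_map (by fun_prop) (hV k)]
  filter_upwards [h1, h2] with ω hω1 hω2
  simp only [mul_one] at hω1
  filter_upwards [h.rademacher.ae_cauchySeq_sum_smul hp (fun k => Γ k ω ^ (-(1 / α)))
    (fun k => Φ (V k ω)) hω1 hω2] with ω' hω'
  exact cauchySeq_tendsto_of_complete hω'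

end IsSignedMarkedArrivals

/-! ### Characteristic functions of the partial sums and of the limit. -/

/-- For `ρ = ±1`, `e^{iρX} = cos X + iρ sin X`, and the last term has mean zero by independence. -/
theorem integral_exp_sign_mul {Ω : Type*} [MeasurableSpace Ω] {P : Measure Ω}
    [IsProbabilityMeasure P] {X ρ : Ω → ℝ} (hX : Measurable X) (hρ : Measurable ρ)
    (hs : ∀ ω, ρ ω = 1 ∨ ρ ω = -1) (h0 : ∫ ω, ρ ω ∂P = 0) (hi : IndepFun X ρ P) :
    ∫ ω, Complex.exp ((ρ ω * X ω : ℝ) * Complex.I) ∂P = ((∫ ω, Real.cos (X ω) ∂P : ℝ) : ℂ) := by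
  have hcos : Integrable (fun ω => Real.cos (X ω)) P :=
    Integrable.of_bound (C := 1) (Measurable.aestronglyMeasurable (by fun_prop))
      (Eventually.of_forall fun ω => Real.abs_cos_le_one _)
  have hsin : Integrable (fun ω => Real.sin (X ω) * ρ ω) P :=
    Integrable.of_bound (C := 1) (Measurable.aestronglyMeasurable (by fun_prop))
      (Eventually.of_forall fun ω => by
        rcases hs ω with h | h <;> simpa [h] using Real.abs_sin_le_one _)
  have h1 : ∀ ω, Complex.exp ((ρ ω * X ω : ℝ) * Complex.I) =
      (Real.cos (X ω) : ℂ) + ((Real.sin (X ω) * ρ ω : ℝ) : ℂ) * Complex.I := by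
    intro ω
    rw [Complex.exp_mul_I, ← Complex.ofReal_cos, ← Complex.ofReal_sin]
    rcases hs ω with h | h <;> simp [h]
  have h2 : ∫ ω, Real.sin (X ω) * ρ ω ∂P = 0 := by
    have := (hi.comp Real.measurable_sin measurable_id).integral_fun_mul_eq_mul_integral
      (hX.sin).aestronglyMeasurable hρ.aestronglyMeasurable
    simp only [Function.comp_apply, id] at this
    rw [this, h0, mul_zero]
  simp_rw [h1]
  rw [integral_add hcos.ofReal (hsin.ofReal.mul_const _), integral_mul_const]
  simp only [integral_complex_ofReal]
  rw [h2]
  simp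

namespace IsSignedMarkedArrivals

variable {Ω Y : Type*} [MeasurableSpace Ω] [MeasurableSpace Y] {P : Measure Ω} {Γ : ℕ → Ω → ℝ}
  {V : ℕ → Ω → Y} {ρ : ℕ → Ω → ℝ} {κ : Measure Y}

theorem isProbabilityMeasure (h : IsSignedMarkedArrivals P Γ V ρ κ) : IsProbabilityMeasure κ := by
  have := h.iIndep_pairs.isProbabilityMeasure
  rw [← h.map_V 0]
  exact Measure.isProbabilityMeasure_map (h.measurable_V 0).aemeasurable

theorem integral_exp_sum (h : IsSignedMarkedArrivals P Γ V ρ κ) {y : Y → ℝ} (hy : Measurable y)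
    (b : ℕ → ℝ) (N : ℕ) :
    ∫ ω, Complex.exp ((∑ k ∈ Finset.range N, ρ k ω * (b k * y (V k ω)) : ℝ) * Complex.I) ∂P =
      ((∏ k ∈ Finset.range N, (1 - ∫ x, (1 - Real.cos (b k * x)) ∂(κ.map y)) : ℝ) : ℂ) := by
  have := h.iIndep_pairs.isProbabilityMeasure
  have := h.isProbabilityMeasure
  have := Measure.isProbabilityMeasure_map (μ := κ) hy.aemeasurable
  have hV : ∀ k, Measurable (V k) := h.measurable_V
  have hρ : ∀ k, Measurable (ρ k) := h.rademacher.measurable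
  have h1 : ∀ k, ∫ ω, Complex.exp ((ρ k ω * (b k * y (V k ω)) : ℝ) * Complex.I) ∂P =
      ((1 - ∫ x, (1 - Real.cos (b k * x)) ∂(κ.map y) : ℝ) : ℂ) := by
    intro k
    rw [integral_exp_sign_mul (X := fun ω => b k * y (V k ω)) (by fun_prop) (hρ k) (h.rademacher.sign k)
      (h.rademacher.integral_eq_zero k)
      ((h.indep_V_ρ k).comp (φ := fun v => b k * y v) (by fun_prop) measurable_id)]
    have hcos : Integrable (fun x => Real.cos (b k * x)) (κ.map y) :=
      Integrable.of_bound (C := 1) (Measurable.aestronglyMeasurable (by fun_prop))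
        (Eventually.of_forall fun ω => Real.abs_cos_le_one _)
    have e : ∫ x, Real.cos (b k * x) ∂(κ.map y) = ∫ ω, Real.cos (b k * y (V k ω)) ∂P := by
      rw [integral_map hy.aemeasurable (Measurable.aestronglyMeasurable (by fun_prop)),
        ← h.map_V k,
        integral_map (hV k).aemeasurable (Measurable.aestronglyMeasurable (by fun_prop))]
    rw [integral_sub (integrable_const _) hcos, e]
    simp
  have h2 : iIndepFun (fun (i : Fin N) ω => (V i ω, ρ i ω)) P :=
    h.iIndep_pairs.precomp Fin.val_injective
  have h3 := iIndepFun.integral_fun_prod_comp (ι := Fin N) (𝓧 := fun _ => Y × ℝ) h2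
    (f := fun (i : Fin N) (q : Y × ℝ) => Complex.exp ((q.2 * (b i * y q.1) : ℝ) * Complex.I))
    (fun i => Measurable.aemeasurable (by fun_prop))
    (fun i => Measurable.aestronglyMeasurable (by fun_prop))
  simp only [h1] at h3
  rw [Complex.ofReal_prod, Finset.prod_range, ← h3]
  refine integral_congr_ae (Eventually.of_forall fun ω => ?_)
  simp only
  rw [← Complex.exp_sum, Finset.sum_range, Complex.ofReal_sum, Finset.sum_mul]

/-- Arrivals are independent of the pairs, so they are frozen first and `integral_exp_sum` is
applied with `b k = θ Γ_k^{-1/α}`. Almost sure positivity of `Γ_k` selects the nontrivial branch of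
`stableExponent`. -/
theorem integral_exp_arrivals_sum (h : IsSignedMarkedArrivals P Γ V ρ κ) {y : Y → ℝ}
    (hy : Measurable y) (α θ : ℝ) (N : ℕ) :
    ∫ ω, Complex.exp ((∑ k ∈ Finset.range N,
      ρ k ω * (θ * Γ k ω ^ (-(1 / α)) * y (V k ω)) : ℝ) * Complex.I) ∂P =
      ((∫ ω, ∏ k ∈ Finset.range N, (1 - stableExponent α (κ.map y) θ (Γ k ω)) ∂P : ℝ) : ℂ) := by
  have := h.iIndep_pairs.isProbabilityMeasure
  have hV : ∀ k, Measurable (V k) := h.measurable_V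
  have hρ : ∀ k, Measurable (ρ k) := h.rademacher.measurable
  have hΓ : ∀ k, Measurable (Γ k) := h.arrivals.measurable
  set g : (ℕ → ℝ) × (ℕ → Y × ℝ) → ℂ := fun q => Complex.exp ((∑ k ∈ Finset.range N,
      (q.2 k).2 * (θ * q.1 k ^ (-(1 / α)) * y (q.2 k).1) : ℝ) * Complex.I) with hg
  have hgm : Measurable g := by fun_prop
  have hYm : Measurable fun ω => (fun k => Γ k ω : ℕ → ℝ) := by fun_prop
  have hZm : Measurable fun ω => (fun k => (V k ω, ρ k ω) : ℕ → Y × ℝ) := by fun_prop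
  have h1 := h.indep_arrivals.integral_fun_prodMk hYm hZm hgm.stronglyMeasurable
    (Integrable.of_bound (C := 1) (hgm.comp (hYm.prodMk hZm)).aestronglyMeasurable
      (Eventually.of_forall fun ω => by simp only [hg, Complex.norm_exp_ofReal_mul_I, le_refl]))
  refine h1.trans ?_
  rw [← integral_complex_ofReal]
  obtain ⟨τ, hm, hl, hi, hΓτ⟩ := h.arrivals
  refine integral_congr_ae ?_
  filter_upwards [ae_pos_of_map_eq_expMeasure hm hl] with ω hω
  rw [integral_map hZm.aemeasurable (Measurable.aestronglyMeasurable (by fun_prop))]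
  refine (h.integral_exp_sum hy (fun k => θ * Γ k ω ^ (-(1 / α))) N).trans ?_
  congr 1
  refine Finset.prod_congr rfl fun k _ => ?_
  rw [stableExponent, if_pos]
  rw [hΓτ]
  exact Finset.sum_pos (fun j _ => hω j) ⟨0, by simp⟩

theorem tendsto_integral_exp_arrivals_sum (h : IsSignedMarkedArrivals P Γ V ρ κ) {y : Y → ℝ}
    (hy : Measurable y) {α r : ℝ} (hα : 0 < α) (hαr : α < r) (hr2 : r ≤ 2)
    (hyr : Integrable (fun v => |y v| ^ r) κ) (θ : ℝ) :
    Tendsto (fun N => ∫ ω, Complex.exp ((∑ k ∈ Finset.range N,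
      ρ k ω * (θ * Γ k ω ^ (-(1 / α)) * y (V k ω)) : ℝ) * Complex.I) ∂P) atTop
      (𝓝 (Real.exp (-(((∫ u in Set.Ioi 0, stableExponent α (κ.map y) 1 u) ^ (1 / α)) ^ α *
        |θ| ^ α)) : ℂ)) := by
  have := h.isProbabilityMeasure
  have := Measure.isProbabilityMeasure_map (μ := κ) hy.aemeasurable
  simp_rw [h.integral_exp_arrivals_sum hy α θ]
  refine (Complex.continuous_ofReal.tendsto _).comp ?_
  obtain ⟨τ, hm, hl, hi, hΓτ⟩ := h.arrivals
  simp_rw [hΓτ]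
  rw [← expNegTail_stableExponent hα]
  refine tendsto_integral_prod_one_sub hm hl hi (integrable_stableExponent hα hαr hr2 ?_ θ)
    (measurable_stableExponent θ) (continuousOn_stableExponent θ) (stableExponent_nonneg θ)
    (stableExponent_le_two θ)
  exact (integrable_map_measure (Measurable.aestronglyMeasurable (by fun_prop))
    hy.aemeasurable).2 hyr

/-- One-dimensional images of the sum of a LePage series are symmetric stable. -/
theorem isSymmetricStableReal_map (h : IsSignedMarkedArrivals P Γ V ρ κ) {F : Type*}
    [NormedAddCommGroup F] [NormedSpace ℝ F] [MeasurableSpace F] [BorelSpace F]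
    [SecondCountableTopology F] {Φ : Y → F} (hΦ : Measurable Φ) {α r : ℝ} (hα : 0 < α)
    (hαr : α < r) (hr2 : r ≤ 2) (hΦr : Integrable (fun v => ‖Φ v‖ ^ r) κ) (c : ℝ) {U : Ω → F}
    (hU : Measurable U)
    (hlim : ∀ᵐ ω ∂P, Tendsto (fun N => c • ∑ k ∈ Finset.range N,
      ρ k ω • Γ k ω ^ (-(1 / α)) • Φ (V k ω)) atTop (𝓝 (U ω))) (l : F →L[ℝ] ℝ) :
    ∃ σ : ℝ, 0 ≤ σ ∧ IsSymmetricStableReal α σ ((P.map U).map l) := by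
  have := h.iIndep_pairs.isProbabilityMeasure
  have hr0 : 0 < r := hα.trans hαr
  have hV : ∀ k, Measurable (V k) := h.measurable_V
  have hρ : ∀ k, Measurable (ρ k) := h.rademacher.measurable
  have hΓ : ∀ k, Measurable (Γ k) := h.arrivals.measurable
  have hlm : Measurable l := l.continuous.measurable
  set y : Y → ℝ := fun v => l (Φ v) with hy
  have hym : Measurable y := by fun_prop
  have hyr : Integrable (fun v => |y v| ^ r) κ := by
    refine Integrable.mono' (hΦr.const_mul (‖l‖ ^ r))
      (Measurable.aestronglyMeasurable (by fun_prop)) (Eventually.of_forall fun v => ?_)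
    rw [Real.norm_of_nonneg (by positivity), ← Real.mul_rpow (norm_nonneg _) (norm_nonneg _)]
    exact Real.rpow_le_rpow (abs_nonneg _) (l.le_opNorm _) hr0.le
  set I := ∫ u in Set.Ioi 0, stableExponent α (κ.map y) 1 u
  have hI : 0 ≤ I := integral_nonneg fun u => stableExponent_nonneg _ _
  have hI' : 0 ≤ I ^ (1 / α) := Real.rpow_nonneg hI _
  -- The prefactor `c` is absorbed by evaluating at `θ = t c`, so it only rescales `σ` by `|c|`.
  refine ⟨I ^ (1 / α) * |c|, by positivity, fun t => ?_⟩
  rw [charFun_apply_real, integral_map hlm.aemeasurable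
    (Measurable.aestronglyMeasurable (by fun_prop)), integral_map hU.aemeasurable
    (Measurable.aestronglyMeasurable (by fun_prop))]
  have h1 := h.tendsto_integral_exp_arrivals_sum hym hα hαr hr2 hyr (t * c)
  have h2 : Tendsto (fun N => ∫ ω, Complex.exp ((∑ k ∈ Finset.range N,
      ρ k ω * (t * c * Γ k ω ^ (-(1 / α)) * y (V k ω)) : ℝ) * Complex.I) ∂P) atTop
      (𝓝 (∫ ω, Complex.exp (t * l (U ω) * Complex.I) ∂P)) := by
    refine tendsto_integral_of_dominated_convergence (fun _ => 1) (fun N => ?_)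
      (integrable_const _) (fun N => ?_) ?_
    · exact Measurable.aestronglyMeasurable (by fun_prop)
    · exact Eventually.of_forall fun ω => by rw [Complex.norm_exp_ofReal_mul_I]
    · filter_upwards [hlim] with ω hω
      have h3 : Tendsto (fun N => t * l (c • ∑ k ∈ Finset.range N,
          ρ k ω • Γ k ω ^ (-(1 / α)) • Φ (V k ω))) atTop (𝓝 (t * l (U ω))) :=
        ((l.continuous.tendsto _).comp hω).const_mul t
      have h4 := (((Complex.continuous_ofReal.tendsto _).comp h3).mul_const Complex.I).cexp
      simp only [Complex.ofReal_mul t] at h4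
      refine h4.congr fun N => ?_
      simp only [Function.comp_apply, map_smul, map_sum, smul_eq_mul, Finset.mul_sum, hy]
      congr 3
      refine Finset.sum_congr rfl fun k _ => ?_
      ring
  rw [tendsto_nhds_unique h2 h1, Complex.ofReal_exp]
  congr 2
  rw [abs_mul, Real.mul_rpow (abs_nonneg _) (abs_nonneg _), Real.mul_rpow hI' (abs_nonneg _)]
  ring

end IsSignedMarkedArrivals

/-! ### Assembly of the main theorem. -/

theorem lintegral_smul_lebesgueOn_lt_top {m : ℕ} {E : Set (EuclideanSpace ℝ (Fin m))}
    (hE0 : 0 < volume E) {g : E → ℝ≥0∞} (hg : ∫⁻ v, g v ∂(lebesgueOn E) < ∞) :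
    ∫⁻ v, g v ∂((volume E)⁻¹ • lebesgueOn E) < ∞ := by
  rw [lintegral_smul_measure]
  exact ENNReal.mul_lt_top (ENNReal.inv_lt_top.2 hE0) hg

/-- On a finite measure space, `x^q ≤ 1 + x^p`. This supplies the moment of order `min p 2` when `p
> 2`. -/
theorem integrable_norm_rpow_of_lintegral_enorm_rpow {Y F : Type*} [MeasurableSpace Y]
    [NormedAddCommGroup F] [MeasurableSpace F] [BorelSpace F] {κ : Measure Y} [IsFiniteMeasure κ]
    {Φ : Y → F} (hΦ : Measurable Φ) {p q : ℝ} (hq : 0 < q)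
    (h : ∫⁻ v, ‖Φ v‖ₑ ^ p ∂κ < ∞) (hqp : q ≤ p) :
    Integrable (fun v => ‖Φ v‖ ^ q) κ := by
  have hp : 0 < p := hq.trans_le hqp
  have h1 : Integrable (fun v => ‖Φ v‖ ^ p) κ := by
    refine ⟨Measurable.aestronglyMeasurable (by fun_prop), ?_⟩
    refine lt_of_eq_of_lt (lintegral_congr fun v => ?_) h
    rw [Real.enorm_eq_ofReal (by positivity), ← ENNReal.ofReal_rpow_of_nonneg (norm_nonneg _) hp.le,
      ofReal_norm]
  refine Integrable.mono' ((integrable_const 1).add h1) (Measurable.aestronglyMeasurable (by fun_prop))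
    (Eventually.of_forall fun v => ?_)
  change ‖‖Φ v‖ ^ q‖ ≤ 1 + ‖Φ v‖ ^ p
  have h2 : 0 ≤ ‖Φ v‖ ^ p := by positivity
  rw [Real.norm_of_nonneg (by positivity)]
  rcases le_total ‖Φ v‖ 1 with hv | hv
  · linarith [Real.rpow_le_one (norm_nonneg _) hv hq.le]
  · linarith [Real.rpow_le_rpow_of_exponent_le hv hqp]

theorem eLpNorm_lePageSum_sub {Ω : Type*} {d m : ℕ} {α : ℝ}
    {T : Set (EuclideanSpace ℝ (Fin d))} {E : Set (EuclideanSpace ℝ (Fin m))} {f : T × E → ℂ}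
    {Γ : ℕ → Ω → ℝ} {V : ℕ → Ω → E} {ρ : ℕ → Ω → ℝ} {p : ℝ≥0∞} [Fact (1 ≤ p)] {ω : Ω}
    (h : ∀ k, MemLp (fun x : T => f (x, V k ω)) p (lebesgueOn T)) (N : ℕ)
    (u : Lp ℂ p (lebesgueOn T)) :
    eLpNorm (fun x : T => lePageSum α f Γ V ρ N ω x - u x) p (lebesgueOn T) =
      ‖((stableConst α * (volume E).toReal) ^ (1 / α)) • ∑ k ∈ Finset.range N,
        ρ k ω • Γ k ω ^ (-(1 / α)) • lpSection f p (lebesgueOn T) (V k ω) - u‖ₑ := by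
  set c := (stableConst α * (volume E).toReal) ^ (1 / α) with hc
  rw [Lp.enorm_def]
  refine eLpNorm_congr_ae ?_
  set S := ∑ k ∈ Finset.range N, ρ k ω • Γ k ω ^ (-(1 / α)) • lpSection f p (lebesgueOn T) (V k ω)
    with hS
  have h1 : S = ∑ k ∈ Finset.range N,
      (ρ k ω * Γ k ω ^ (-(1 / α))) • lpSection f p (lebesgueOn T) (V k ω) := by
    simp_rw [hS, smul_smul]
  have h2 := Lp.coeFn_finset_sum_smul_ae (μ := lebesgueOn T) (Finset.range N)
    (fun k => ρ k ω * Γ k ω ^ (-(1 / α))) fun k => lpSection f p (lebesgueOn T) (V k ω)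
  rw [← h1] at h2
  filter_upwards [h2, Lp.coeFn_smul c S, Lp.coeFn_sub (c • S) u,
    ae_all_iff.2 fun k => coeFn_lpSection (h k)] with x h2 h3 h4 h5
  rw [h4, Pi.sub_apply, h3, Pi.smul_apply, h2, lePageSum]
  simp [h5, hc]

theorem mainTheorem7 {Ω : Type*} [MeasurableSpace Ω] (P : Measure Ω) [IsProbabilityMeasure P]
    (d m : ℕ) (α : ℝ) (hα0 : 0 < α) (hα2 : α < 2)
    (p : ℝ≥0∞) [Fact (1 ≤ p)] (hp : p ≠ ∞) (hαp : α < p.toReal)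
    (E : Set (EuclideanSpace ℝ (Fin m))) (hE : MeasurableSet E)
    (hE0 : 0 < volume E) (hE1 : volume E < ∞)
    (Γ : ℕ → Ω → ℝ) (V : ℕ → Ω → E) (ρ : ℕ → Ω → ℝ) (hin : IsLePageInput P E Γ V ρ)
    (T : Set (EuclideanSpace ℝ (Fin d))) (hT : NullMeasurableSet T volume) (hT0 : 0 < volume T)
    (f : T × E → ℂ) (hf : Measurable f)
    (hfp : ∫⁻ x, ∫⁻ x', ‖f (x, x')‖ₑ ^ p.toReal ∂(lebesgueOn E) ∂(lebesgueOn T) < ∞) :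
    ∃ U : Ω → Lp ℂ p (lebesgueOn T),
      Measurable U ∧
      (∀ᵐ ω ∂P,
        (∀ k, MemLp (fun x : T => f (x, V k ω)) p (lebesgueOn T)) ∧
        Tendsto (fun N => eLpNorm (fun x : T => lePageSum α f Γ V ρ N ω x - U ω x) p (lebesgueOn T))
          atTop (𝓝 0)) ∧
      IsSymmetricAlphaStable α (P.map U) := by
  have hp0 : p ≠ 0 := (zero_lt_one.trans_le (Fact.out : 1 ≤ p)).ne'
  have hpp : 0 < p.toReal := ENNReal.toReal_pos hp0 hp
  have : Fact (p ≠ ∞) := ⟨hp⟩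
  have h := hin.isSignedMarkedArrivals hE
  have := h.isProbabilityMeasure
  set κ := (volume E)⁻¹ • lebesgueOn E
  set Φ : E → Lp ℂ p (lebesgueOn T) := lpSection f p (lebesgueOn T)
  have hΦ : Measurable Φ := measurable_lpSection hp hf
  have hV : ∀ k, Measurable (V k) := h.measurable_V
  have hρ : ∀ k, Measurable (ρ k) := h.rademacher.measurable
  have hΓ : ∀ k, Measurable (Γ k) := h.arrivals.measurable
  rw [lintegral_lintegral_swap (by fun_prop)] at hfp
  have hfp' := lintegral_smul_lebesgueOn_lt_top hE0 hfp
  have hmem : ∀ᵐ v ∂κ, MemLp (fun x : T => f (x, v)) p (lebesgueOn T) := by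
    have hmeas : Measurable fun v : E => ∫⁻ x : T, ‖f (x, v)‖ₑ ^ p.toReal ∂(lebesgueOn T) :=
      Measurable.lintegral_prod_left' (f := fun q : T × E => ‖f q‖ₑ ^ p.toReal) (by fun_prop)
    filter_upwards [ae_lt_top hmeas hfp'.ne] with v hv
    refine ⟨(hf.comp measurable_prodMk_right).aestronglyMeasurable, ?_⟩
    rw [eLpNorm_eq_lintegral_rpow_enorm_toReal hp0 hp]
    exact ENNReal.rpow_lt_top_of_nonneg (by positivity) hv.ne
  have hΦp : ∫⁻ v, ‖Φ v‖ₑ ^ p.toReal ∂κ < ∞ := by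
    refine lt_of_le_of_lt (lintegral_mono fun v => ?_) hfp'
    refine (ENNReal.rpow_le_rpow (enorm_lpSection_le v) hpp.le).trans_eq ?_
    rw [eLpNorm_eq_lintegral_rpow_enorm_toReal hp0 hp, ← ENNReal.rpow_mul,
      one_div_mul_cancel hpp.ne', ENNReal.rpow_one]
  have hmemV : ∀ᵐ ω ∂P, ∀ k, MemLp (fun x : T => f (x, V k ω)) p (lebesgueOn T) := by
    refine ae_all_iff.2 fun k => ?_
    rw [← h.map_V k] at hmem
    exact ae_of_ae_map (hV k).aemeasurable hmem
  -- The limit exists only almost everywhere; `S` is a version of it measurable on all of `Ω`.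
  obtain ⟨S, hSm, hS⟩ := measurable_limit_of_tendsto_metrizable_ae (L := atTop)
    (f := fun N ω => ∑ k ∈ Finset.range N, ρ k ω • Γ k ω ^ (-(1 / α)) • Φ (V k ω))
    (fun N => Measurable.aemeasurable (by fun_prop))
    (h.ae_exists_tendsto hp hα0 hα2 hαp hΦ hΦp.ne)
  set c : ℝ := (stableConst α * (volume E).toReal) ^ (1 / α)
  have hU : Measurable fun ω => c • S ω := by fun_prop
  have hlim : ∀ᵐ ω ∂P, Tendsto (fun N => c • ∑ k ∈ Finset.range N,
      ρ k ω • Γ k ω ^ (-(1 / α)) • Φ (V k ω)) atTop (𝓝 (c • S ω)) := by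
    filter_upwards [hS] with ω hω using hω.const_smul c
  refine ⟨fun ω => c • S ω, hU, ?_, ?_⟩
  · filter_upwards [hmemV, hlim] with ω hω hlω
    refine ⟨hω, ?_⟩
    simp_rw [eLpNorm_lePageSum_sub hω]
    exact (tendsto_iff_edist_tendsto_0.1 hlω).congr fun N => edist_eq_enorm_sub _ _
  · have := Measure.isProbabilityMeasure_map (μ := P) hU.aemeasurable
    refine isSymmetricAlphaStable_of_forall_map hα0 _ fun l => ?_
    have hr : 0 < min p.toReal 2 := lt_min hpp two_pos
    exact h.isSymmetricStableReal_map hΦ hα0 (lt_min hαp hα2) (min_le_right _ _)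
      (integrable_norm_rpow_of_lintegral_enorm_rpow hΦ hr hΦp (min_le_left _ _)) c hU hlim l
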